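/- Let $n\ge 3$. A set $A\subseteq\mathbb F_5^n$ is called \emph{sum-free} if there are no $x,y,z\in A$ with $x+y=z$. A sum-free set $A\subseteq\mathbb F_5^n$ is called \emph{normal} if there is an affine hyperplane $H\subseteq\mathbb F_5^n$ not containing the origin such that $A\subseteq H\cup(-H)$. Let $\Lambda\subseteq\mathbb F_5^3$ be the $28$-element set $$\Lambda=\bigl(\{(1,0),(-1,0),(0,1),(0,-1)\}\times\mathbb F_5\bigr)\cup\{(-1,2,0),(-1,2,1),(2,1,1),(2,1,2),(1,-2,0),(1,-2,-1),(-2,-1,-1),(-2,-1,-2)\},$$ and call a subset of $\mathbb F_5^n$ a \emph{VL-set} if it is the image of $\Lambda\times\mathbb F_5^{n-3}$ under some linear automorphism of $\mathbb F_5^n$ (where $\mathbb F_5^3\times\mathbb F_5^{n-3}$ is identified with $\mathbb F_5^n$). If $A\subseteq\mathbb F_5^n$ is sum-free with $|A|\ge 28\cdot 5^{n-3}$, and some affine subspace $T$ of $\mathbb F_5^n$ of codimension $2$ satisfies $|A\cap T|>3\cdot 5^{n-3}$, then $A$ is normal or a VL-set. -/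

import Mathlib

/-- A subset of an abelian group is sum-free if `x + y = z` has no solution inside it. -/
def IsSumFree {G : Type*} [AddCommGroup G] (A : Set G) : Prop :=
  ∀ x ∈ A, ∀ y ∈ A, x + y ∉ A

/-- `T` is a (nonempty) affine subspace of `𝔽₅ⁿ` of codimension `k`. -/
def HasCodim {n : ℕ} (T : AffineSubspace (ZMod 5) (Fin n → ZMod 5)) (k : ℕ) : Prop :=
  (T : Set (Fin n → ZMod 5)).Nonempty ∧ Module.finrank (ZMod 5) T.direction + k = n

/-- A sum-free set is normal if it is contained in `H ∪ (-H)` for some affine hyperplane `H`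
not passing through the origin. -/
def IsNormalSumFree {n : ℕ} (A : Set (Fin n → ZMod 5)) : Prop :=
  IsSumFree A ∧ ∃ H : AffineSubspace (ZMod 5) (Fin n → ZMod 5),
    HasCodim H 1 ∧ 0 ∉ H ∧ ∀ x ∈ A, x ∈ H ∨ -x ∈ H

/-- The set `Λ ⊆ 𝔽₅³` with `28` elements. -/
def Lambda : Set (Fin 3 → ZMod 5) :=
  {p | ∃ z : ZMod 5, p = ![1, 0, z] ∨ p = ![-1, 0, z] ∨ p = ![0, 1, z] ∨ p = ![0, -1, z]} ∪
  {![-1, 2, 0], ![-1, 2, 1], ![2, 1, 1], ![2, 1, 2],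
   ![1, -2, 0], ![1, -2, -1], ![-2, -1, -1], ![-2, -1, -2]}

/-- A subset of `𝔽₅ⁿ` is a VL-set if some linear isomorphism `𝔽₅ⁿ ≃ 𝔽₅³ × 𝔽₅ⁿ⁻³` maps it onto
`Λ × 𝔽₅ⁿ⁻³`. (For `n < 3` there is no such isomorphism.) -/
def IsVLSet {n : ℕ} (A : Set (Fin n → ZMod 5)) : Prop :=
  ∃ φ : (Fin n → ZMod 5) ≃ₗ[ZMod 5] (Fin 3 → ZMod 5) × (Fin (n - 3) → ZMod 5),
    φ '' A = Lambda ×ˢ (Set.univ : Set (Fin (n - 3) → ZMod 5))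

/-!
Let `φ` be a linear map onto the plane `𝔽₅²` whose kernel is the direction of the dense flat `T`.
Since `A` is sum-free, the numbers of its elements in the fibres of `φ` satisfy linear inequalities:
the sum of two fibres avoids a third one, which is quantified by Kneser's theorem, and if `A` is not
normal, then no affine hyperplane has more than half of its points in `A`. Together with
`|A| ≥ 28 * 5 ^ (n - 3)` these inequalities are so strong that a case distinction on which fibres
are empty, each case being a linear program, leaves only one support: `±e₁`, `±e₂` and the points
`g`, `2g`, `4g`, `3g` for `g = 2e₁ + e₂`. The single exception is a profile that is constant off a
line through `0`; in this case `A` has a flat of density above `4 / 5`, to which the argument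
applies.

For the remaining support all the inequalities are equalities: the fibres over `±e₁`, `±e₂` are
full and those over `g`, `2g`, `4g`, `3g` have density `2 / 5`. By Kneser's theorem the fibre over
`2g` is a union of two cosets of a subspace of codimension `3`, which gives the third coordinate of
a map to `𝔽₅³`. Doubling then determines the fibres over `4g`, `3g`, `g` and again `2g` in turn, and
they are those of `Λ`.
-/

section

theorem fact_prime_five : Fact (Nat.Prime 5) := ⟨Nat.prime_five⟩

attribute [local instance] fact_prime_five

/-- The plane `𝔽₅²`, which indexes the fibres of a linear map onto it. -/
abbrev Plane := ZMod 5 × ZMod 5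

/-- The sum of a function over the row at height `j`. -/
def rowSum (x : Plane → ℕ) (j : ZMod 5) : ℕ := ∑ i, x (i, j)

/-- The inequalities satisfied by the numbers `x g` of elements of a sum-free set in the fibres of a
linear map onto the plane, the fibres having `5 * q` elements each and `q` being a power of `5`. -/
structure SumFreeProfile (x : Plane → ℕ) (q : ℕ) : Prop where
  pos : 0 < q
  pair : ∀ g h, 0 < x g → x h + x (g + h) ≤ 5 * q
  pairSum : ∀ g h, 0 < x (g + h) → x g + x h ≤ 5 * q
  triple : ∀ g h m, 0 < x g → 0 < x h → 0 < x (g + h) → m * q < x g →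
    x h + x (g + h) + m * q ≤ 5 * q
  tripleSum : ∀ g h m, 0 < x g → 0 < x h → 0 < x (g + h) → m * q < x (g + h) →
    x g + x h + m * q ≤ 5 * q
  dir : ∀ d g, d ≠ 0 → 0 < x d → ∑ k : ZMod 5, x (g + k • d) ≤ 10 * q

/-- The inequalities satisfied by the numbers `x g` of elements of a sum-free set that is large and
not normal in the fibres of a linear map onto the plane. -/
structure Profile (x : Plane → ℕ) (q : ℕ) : Prop extends SumFreeProfile x q where
  line : ∀ d g, d ≠ 0 → 2 * ∑ k : ZMod 5, x (g + k • d) ≤ 25 * q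
  total : 28 * q ≤ ∑ g, x g

/-- The image in the plane of `{±e₁, ±e₂} × 𝔽₅ ⊆ Λ`. -/
def axisPoints : List Plane := [(1, 0), (4, 0), (0, 1), (0, 4)]

/-- The image in the plane of the eight elements of `Λ` outside `{±e₁, ±e₂} × 𝔽₅`. -/
def halfPoints : List Plane := [(2, 1), (4, 2), (1, 3), (3, 4)]

/-- A function on the plane is exceptional if in suitable coordinates its support is that of the
profile of a VL-set, except that some of the points `±e₁`, `±e₂` may be missing. -/
def IsExceptional (x : Plane → ℕ) : Prop :=
  ∃ ψ : Plane ≃ₗ[ZMod 5] Plane,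
    (∀ g, 0 < x (ψ g) → g ∈ axisPoints ∨ g ∈ halfPoints) ∧ ∀ g ∈ halfPoints, 0 < x (ψ g)

theorem IsExceptional.of_comp {x : Plane → ℕ} {ψ : Plane ≃ₗ[ZMod 5] Plane}
    (h : IsExceptional (x ∘ ψ)) : IsExceptional x :=
  let ⟨χ, hχ⟩ := h
  ⟨χ.trans ψ, hχ⟩

/-- The linear automorphism `(i, j) ↦ (a * i + c * j, d * j)`. -/
def triangular {a d : ZMod 5} (ha : a ≠ 0) (c : ZMod 5) (hd : d ≠ 0) :
    Plane ≃ₗ[ZMod 5] Plane where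
  toFun p := (a * p.1 + c * p.2, d * p.2)
  invFun p := (a⁻¹ * (p.1 - c * (d⁻¹ * p.2)), d⁻¹ * p.2)
  map_add' p r := by ext <;> simp only [Prod.fst_add, Prod.snd_add] <;> ring
  map_smul' k p := by
    ext <;> simp only [Prod.smul_fst, Prod.smul_snd, smul_eq_mul, RingHom.id_apply] <;> ring
  left_inv p := by ext <;> simp [ha, hd]
  right_inv p := by ext <;> simp [ha, hd]

theorem triangular_apply {a d : ZMod 5} (ha : a ≠ 0) (c : ZMod 5) (hd : d ≠ 0) (p : Plane) :
    triangular ha c hd p = (a * p.1 + c * p.2, d * p.2) := rfl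

theorem rowSum_comp_triangular (x : Plane → ℕ) {a d : ZMod 5} (ha : a ≠ 0) (c : ZMod 5)
    (hd : d ≠ 0) (j : ZMod 5) : rowSum (x ∘ triangular ha c hd) j = rowSum x (d * j) :=
  Equiv.sum_comp ((Equiv.mulLeft₀ a ha).trans (Equiv.addRight (c * j))) fun i => x (i, d * j)

theorem sum_eq_rowSum (x : Plane → ℕ) :
    ∑ g, x g = rowSum x 0 + rowSum x 1 + rowSum x 2 + rowSum x 3 + rowSum x 4 := by
  rw [Fintype.sum_prod_type_right]
  exact Fin.sum_univ_five (rowSum x)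

namespace SumFreeProfile

variable {x : Plane → ℕ} {q : ℕ}

theorem le (P : SumFreeProfile x q) (g : Plane) : x g ≤ 5 * q := by
  rcases Nat.eq_zero_or_pos (x g) with h | h
  · exact h ▸ Nat.zero_le _
  · exact (Nat.le_add_right _ _).trans (P.pair g g h)

theorem triple_le (P : SumFreeProfile x q) {g h : Plane} (hg : 0 < x g) (hh : 0 < x h)
    (hgh : 0 < x (g + h)) : x g + x h + x (g + h) ≤ 6 * q := by
  have hlt : (x g - 1) / q * q < x g := by have := Nat.div_mul_le_self (x g - 1) q; omega
  have hle : x g - 1 < (x g - 1) / q * q + q := Nat.lt_div_mul_add P.pos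
  have := P.triple g h _ hg hh hgh hlt
  omega

theorem comp (P : SumFreeProfile x q) (ψ : Plane ≃ₗ[ZMod 5] Plane) : SumFreeProfile (x ∘ ψ) q where
  pos := P.pos
  pair g h := by simpa using P.pair (ψ g) (ψ h)
  pairSum g h := by simpa using P.pairSum (ψ g) (ψ h)
  triple g h := by simpa using P.triple (ψ g) (ψ h)
  tripleSum g h := by simpa using P.tripleSum (ψ g) (ψ h)
  dir d g hd := by simpa using P.dir (ψ d) (ψ g) (by simpa using hd)

end SumFreeProfile

theorem Profile.comp {x : Plane → ℕ} {q : ℕ} (P : Profile x q) (ψ : Plane ≃ₗ[ZMod 5] Plane) :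
    Profile (x ∘ ψ) q where
  toSumFreeProfile := P.toSumFreeProfile.comp ψ
  line d g hd := by simpa using P.line (ψ d) (ψ g) (by simpa using hd)
  total := P.total.trans (Equiv.sum_comp ψ.toEquiv x).ge

/-- A profile in which the weight at `(1, 0)` is maximal, up to rounding up to multiples of `q`,
and the row at height `1` has maximal sum among the nonzero rows. -/
structure NormalizedProfile (x : Plane → ℕ) (q m : ℕ) : Prop extends Profile x q where
  le_mul : ∀ g, x g ≤ (m + 1) * q
  mul_lt : m * q < x (1, 0)
  rowSum_le : ∀ j, j ≠ 0 → rowSum x j ≤ rowSum x 1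

theorem NormalizedProfile.lt_five {x : Plane → ℕ} {q m : ℕ} (N : NormalizedProfile x q m) :
    m < 5 :=
  lt_of_mul_lt_mul_right (N.mul_lt.trans_le (N.le _)) (Nat.zero_le q)

theorem NormalizedProfile.add_reflect_le {x : Plane → ℕ} {q m : ℕ} (N : NormalizedProfile x q m)
    {g : Plane} (hg : (1, 0) - g = g ∨ 0 < x g ∧ 0 < x ((1, 0) - g)) :
    x g + x ((1, 0) - g) + m * q ≤ 5 * q := by
  by_cases hpos : 0 < x g ∧ 0 < x ((1, 0) - g)
  · have h := add_sub_cancel g (1, 0)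
    exact N.tripleSum g _ m hpos.1 hpos.2 (by rw [h]; exact (Nat.zero_le _).trans_lt N.mul_lt)
      (by rw [h]; exact N.mul_lt)
  · have hgg := hg.resolve_right hpos
    have hm := Nat.mul_le_mul_right q N.lt_five.le
    rw [hgg] at hpos ⊢
    omega

/-- The linear inequalities from which the certificates are built. -/
inductive Cut
  | point (g : Plane)
  | pair (g h : Plane)
  | sum (g h : Plane)
  | triple (g h : Plane)
  | shift (g : Plane)
  | reflect (g : Plane)
  | line (d g : Plane)
  | dir (d g : Plane)
  | row (j : ZMod 5)

namespace Cut

/-- The coefficients of the left-hand side of a cut. -/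
def weight : Cut → Plane → ℤ
  | point g => Pi.single g 1
  | pair g h => Pi.single h 1 + Pi.single (g + h) 1
  | sum g h => Pi.single g 1 + Pi.single h 1
  | triple g h => Pi.single g 1 + Pi.single h 1 + Pi.single (g + h) 1
  | shift g => Pi.single g 1 + Pi.single ((1, 0) + g) 1
  | reflect g => Pi.single g 1 + Pi.single ((1, 0) - g) 1
  | line d g => ∑ k : ZMod 5, Pi.single (g + k • d) 1
  | dir d g => ∑ k : ZMod 5, Pi.single (g + k • d) 1
  | row j => ∑ i, Pi.single (i, j) 1 - ∑ i, Pi.single (i, 1) 1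

/-- Twice the right-hand side of a cut, in multiples of `q`. -/
def bound (m : ℕ) : Cut → ℤ
  | point _ => 2 * (m + 1)
  | pair _ _ => 10
  | sum _ _ => 10
  | triple _ _ => 12
  | shift _ => 2 * (5 - m)
  | reflect _ => 2 * (5 - m)
  | line _ _ => 25
  | dir _ _ => 20
  | row _ => 0

/-- The condition under which a cut holds for profiles that are positive on `occ`. -/
def admissible (occ : List Plane) : Cut → Bool
  | point _ => true
  | pair g _ => g ∈ occ
  | sum g h => g + h ∈ occ
  | triple g h => g ∈ occ ∧ h ∈ occ ∧ g + h ∈ occ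
  | shift g => g ∈ occ ∧ (1, 0) + g ∈ occ
  | reflect g => (1, 0) - g = g ∨ g ∈ occ ∧ (1, 0) - g ∈ occ
  | line d _ => d ≠ 0
  | dir d _ => d ≠ 0 ∧ d ∈ occ
  | row j => j ≠ 0

/-- The value of the left-hand side of a cut. -/
def eval (c : Cut) (x : Plane → ℕ) : ℤ := ∑ p, c.weight p * x p

theorem sum_single_mul (g : Plane) (x : Plane → ℕ) :
    ∑ p, (Pi.single g 1 : Plane → ℤ) p * x p = x g := by
  simp [Pi.single_apply]

theorem sum_sum_single_mul (f : ZMod 5 → Plane) (x : Plane → ℕ) :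
    ∑ p, (∑ k, Pi.single (f k) 1 : Plane → ℤ) p * x p = ↑(∑ k, x (f k)) := by
  simp only [Finset.sum_apply, Finset.sum_mul, Nat.cast_sum]
  rw [Finset.sum_comm]
  simp only [sum_single_mul]

variable {x : Plane → ℕ} {q m : ℕ} {occ : List Plane}

theorem two_mul_eval_le (N : NormalizedProfile x q m) (hocc : ∀ g ∈ occ, 0 < x g) {c : Cut}
    (hc : c.admissible occ) : 2 * c.eval x ≤ c.bound m * q := by
  have hpos : 0 < x (1, 0) := (Nat.zero_le _).trans_lt N.mul_lt
  cases c <;>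
    simp only [admissible, decide_eq_true_eq, Bool.decide_and, Bool.and_eq_true, Bool.or_eq_true,
      Bool.decide_or] at hc <;>
    simp only [eval, weight, bound, Pi.add_apply, Pi.sub_apply, add_mul, sub_mul,
      Finset.sum_add_distrib, Finset.sum_sub_distrib, sum_single_mul, sum_sum_single_mul]
  case point g =>
    have := N.le_mul g
    zify at this
    linarith
  case pair g h =>
    have := N.pair g h (hocc g hc)
    omega
  case sum g h =>
    have := N.pairSum g h (hocc _ hc)
    omega
  case triple g h =>
    have := N.triple_le (hocc g hc.1) (hocc h hc.2.1) (hocc _ hc.2.2)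
    omega
  case shift g =>
    have := N.triple (1, 0) g m hpos (hocc _ hc.1) (hocc _ hc.2) N.mul_lt
    zify at this
    linarith
  case reflect g =>
    have := N.add_reflect_le (hc.imp_right fun h => ⟨hocc _ h.1, hocc _ h.2⟩)
    zify at this
    linarith
  case line d g =>
    have := N.line d g hc
    omega
  case dir d g =>
    have := N.dir d g hc.1 (hocc d hc.2)
    omega
  case row j =>
    have := N.rowSum_le j hc
    simp only [rowSum] at this
    omega

end Cut

/-- The coefficients of a nonnegative integral combination of cuts. -/
def totalWeight (cuts : List (ℕ × Cut)) (p : Plane) : ℤ :=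
  (cuts.map fun c => (c.1 : ℤ) * c.2.weight p).sum

/-- The bound of a nonnegative integral combination of cuts. -/
def totalBound (m : ℕ) (cuts : List (ℕ × Cut)) : ℤ :=
  (cuts.map fun c => (c.1 : ℤ) * c.2.bound m).sum

/-- A case distinction on which weights vanish. A leaf `leaf t cuts` is refuted by a combination of
cuts that bounds `t` times the total weight, and at a leaf `exceptional a c d` the map
`triangular a c d` brings the support to the exceptional form. -/
inductive CaseTree
  | exceptional (a c d : ZMod 5)
  | leaf (t : ℕ) (cuts : List (ℕ × Cut))
  | split (g : Plane) (occupied empty : CaseTree)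

/-- Checks a case distinction, where the weights are positive on `occ` and vanish on `emp`. -/
def CaseTree.check (m : ℕ) : List Plane → List Plane → CaseTree → Bool
  | occ, emp, exceptional a c d =>
    a ≠ 0 ∧ d ≠ 0 ∧
      (∀ p : Plane, (a * p.1 + c * p.2, d * p.2) ∈ emp ∨ p ∈ axisPoints ∨ p ∈ halfPoints) ∧
      ∀ p ∈ halfPoints, (a * p.1 + c * p.2, d * p.2) ∈ occ
  | occ, emp, leaf t cuts =>
    let slack := totalWeight cuts (1, 0) - t
    (∀ c ∈ cuts, c.2.admissible occ) ∧ (∀ p, p ∈ emp ∨ t ≤ totalWeight cuts p) ∧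
      totalBound m cuts ≤ 56 * t + 2 * slack * m ∧
      (totalBound m cuts < 56 * t + 2 * slack * m ∨ 0 < slack)
  | occ, emp, split g T U => T.check m (g :: occ) emp && U.check m occ (g :: emp)

namespace NormalizedProfile

variable {x : Plane → ℕ} {q m : ℕ} {occ emp : List Plane}

theorem two_mul_sum_totalWeight_le (N : NormalizedProfile x q m) (hocc : ∀ g ∈ occ, 0 < x g)
    {cuts : List (ℕ × Cut)} (hcuts : ∀ c ∈ cuts, c.2.admissible occ) :
    2 * ∑ p, totalWeight cuts p * x p ≤ totalBound m cuts * q := by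
  induction cuts with
  | nil => simp [totalWeight, totalBound]
  | cons c cuts ih =>
    have hc := Cut.two_mul_eval_le N hocc (hcuts c List.mem_cons_self)
    have ih := ih fun c hc => hcuts c (List.mem_cons_of_mem _ hc)
    have hsum : ∑ p, totalWeight (c :: cuts) p * x p =
        c.1 * c.2.eval x + ∑ p, totalWeight cuts p * x p := by
      simp only [totalWeight, Cut.eval, List.map_cons, List.sum_cons, add_mul, mul_assoc,
        Finset.sum_add_distrib, Finset.mul_sum]
    have hbound : totalBound m (c :: cuts) = c.1 * c.2.bound m + totalBound m cuts := rfl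
    rw [hsum, hbound]
    have := mul_le_mul_of_nonneg_left hc (Int.natCast_nonneg c.1)
    linarith

theorem false_of_totalWeight (N : NormalizedProfile x q m) (hocc : ∀ g ∈ occ, 0 < x g)
    (hemp : ∀ g ∈ emp, x g = 0) {t : ℕ} {cuts : List (ℕ × Cut)}
    (hcuts : ∀ c ∈ cuts, c.2.admissible occ) (ht : ∀ p, p ∈ emp ∨ t ≤ totalWeight cuts p)
    {slack : ℤ} (hslack : slack = totalWeight cuts (1, 0) - t)
    (hle : totalBound m cuts ≤ 56 * t + 2 * slack * m)
    (hlt : totalBound m cuts < 56 * t + 2 * slack * m ∨ 0 < slack) : False := by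
  have hq : (0 : ℤ) < q := by exact_mod_cast N.pos
  have htotal : (28 * q : ℤ) ≤ ∑ p, (x p : ℤ) := by exact_mod_cast N.total
  have hx : (m * q : ℤ) < x (1, 0) := by exact_mod_cast N.mul_lt
  have hterm : ∀ p, 0 ≤ (totalWeight cuts p - t) * x p := by
    intro p
    rcases ht p with hp | hp
    · simp [hemp p hp]
    · exact mul_nonneg (sub_nonneg.2 hp) (Int.natCast_nonneg _)
  have hslack0 : 0 ≤ slack := by
    have := hterm (1, 0)
    rw [← hslack] at this
    nlinarith
  have hlow : t * ∑ p, (x p : ℤ) + slack * x (1, 0) ≤ ∑ p, totalWeight cuts p * x p := by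
    have := Finset.single_le_sum (fun p _ => hterm p) (Finset.mem_univ (1, 0))
    simp only [sub_mul, Finset.sum_sub_distrib, ← Finset.mul_sum] at this
    rw [hslack, sub_mul]
    linarith
  have hupp := N.two_mul_sum_totalWeight_le hocc hcuts
  have h1 : (t : ℤ) * (28 * q) ≤ t * ∑ p, (x p : ℤ) :=
    mul_le_mul_of_nonneg_left htotal (Int.natCast_nonneg t)
  have h2 := mul_le_mul_of_nonneg_right hle hq.le
  rcases hlt with hlt | hlt
  · have h3 := mul_lt_mul_of_pos_right hlt hq
    have h4 := mul_le_mul_of_nonneg_left hx.le hslack0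
    linarith
  · have h4 := mul_lt_mul_of_pos_left hx hlt
    linarith

theorem isExceptional_of_check (N : NormalizedProfile x q m) :
    ∀ (T : CaseTree) (occ emp : List Plane), (∀ g ∈ occ, 0 < x g) → (∀ g ∈ emp, x g = 0) →
      T.check m occ emp → IsExceptional x := by
  intro T
  induction T with
  | exceptional a c d =>
    intro occ emp hocc hemp h
    obtain ⟨ha, hd, hsupp, hhalf⟩ := of_decide_eq_true h
    refine ⟨triangular ha c hd, fun g hg => ?_, fun g hg => hocc _ (hhalf g hg)⟩
    exact (hsupp g).resolve_left fun hmem => hg.ne' (hemp _ hmem)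
  | leaf t cuts =>
    intro occ emp hocc hemp h
    obtain ⟨hcuts, ht, hle, hlt⟩ := of_decide_eq_true h
    exact (N.false_of_totalWeight hocc hemp hcuts ht rfl hle hlt).elim
  | split g T U ihT ihU =>
    intro occ emp hocc hemp h
    obtain ⟨hT, hU⟩ := Bool.and_eq_true_iff.1 h
    rcases Nat.eq_zero_or_pos (x g) with hg | hg
    · exact ihU occ (g :: emp) hocc (List.forall_mem_cons.2 ⟨hg, hemp⟩) hU
    · exact ihT (g :: occ) emp (List.forall_mem_cons.2 ⟨hg, hocc⟩) hemp hT

end NormalizedProfile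

theorem support_zmod_five (S : Finset (ZMod 5)) :
    S = Finset.univ ∨ S = ∅ ∨ (∃ i, S = {i}) ∨ (∃ i, S = {1 + i, 4 + i}) ∨
      (∃ i, S = {i, 2 + i, 3 + i}) ∨ ∃ i j, S = {i, i + 1} ∪ {j, j + 1} := by
  revert S
  decide

theorem two_mul_sum_le_of_cycle {y : ZMod 5 → ℕ} {B : ℕ} (h : ∀ i, y i + y (i + 1) ≤ B) :
    2 * ∑ i, y i ≤ 5 * B := by
  have hshift : ∑ i, y (i + 1) = ∑ i, y i := Equiv.sum_comp (Equiv.addRight 1) y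
  calc 2 * ∑ i, y i = ∑ i, (y i + y (i + 1)) := by rw [Finset.sum_add_distrib, hshift, two_mul]
    _ ≤ ∑ _i : ZMod 5, B := Finset.sum_le_sum fun i _ => h i
    _ = 5 * B := by simp

theorem eq_of_cycle {y : ZMod 5 → ℕ} {q : ℕ} (h : ∀ i, y i + y (i + 1) ≤ 2 * q)
    (hs : ∑ i, y i = 5 * q) (i : ZMod 5) : y i = q := by
  have hsum : ∑ i, y i = y 0 + y 1 + y 2 + y 3 + y 4 := Fin.sum_univ_five y
  have h' : y 0 + y 1 ≤ 2 * q ∧ y 1 + y 2 ≤ 2 * q ∧ y 2 + y 3 ≤ 2 * q ∧ y 3 + y 4 ≤ 2 * q ∧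
    y 4 + y 0 ≤ 2 * q := ⟨h 0, h 1, h 2, h 3, h 4⟩
  have key : y 0 = q ∧ y 1 = q ∧ y 2 = q ∧ y 3 = q ∧ y 4 = q := by omega
  fin_cases i
  exacts [key.1, key.2.1, key.2.2.1, key.2.2.2.1, key.2.2.2.2]

theorem cycle_cases (y : ZMod 5 → ℕ) (B : ℕ)
    (h : ∀ i, 0 < y i → 0 < y (i + 1) → y i + y (i + 1) ≤ B) :
    (∃ i, ∀ k, 0 < y k ↔ k = i) ∨ (∃ i, ∀ k, 0 < y k ↔ k = 1 + i ∨ k = 4 + i) ∨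
      (∃ i, ∀ k, 0 < y k ↔ k = i ∨ k = 2 + i ∨ k = 3 + i) ∨
      ∑ i, y i ≤ 2 * B ∨ ∀ i, y i + y (i + 1) ≤ B := by
  set S := Finset.univ.filter (0 < y ·) with hS
  have hmem : ∀ k, 0 < y k ↔ k ∈ S := by simp [hS]
  have hsum : ∑ i, y i = ∑ i ∈ S, y i := by
    refine (Finset.sum_subset S.subset_univ fun k _ hk => ?_).symm
    exact Nat.eq_zero_of_not_pos (mt (hmem k).1 hk)
  have hedge : ∀ i, {i, i + 1} ⊆ S → ∑ k ∈ {i, i + 1}, y k ≤ B := by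
    intro i hi
    rw [Finset.sum_pair (by simp)]
    exact h i ((hmem i).2 (hi (by simp))) ((hmem _).2 (hi (by simp)))
  rcases support_zmod_five S with h' | h' | ⟨i, h'⟩ | ⟨i, h'⟩ | ⟨i, h'⟩ | ⟨i, j, h'⟩
  · exact .inr (.inr (.inr (.inr fun i => h i (by simp [hmem, h']) (by simp [hmem, h']))))
  · exact .inr (.inr (.inr (.inl (by simp [hsum, h']))))
  · exact .inl ⟨i, by simp [hmem, h']⟩
  · exact .inr (.inl ⟨i, by simp [hmem, h']⟩)
  · exact .inr (.inr (.inl ⟨i, by simp [hmem, h']⟩))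
  · refine .inr (.inr (.inr (.inl ?_)))
    have hi := hedge i (h' ▸ Finset.subset_union_left)
    have hj := hedge j (h' ▸ Finset.subset_union_right)
    have hunion := Finset.sum_union_inter (f := y) (s₁ := {i, i + 1}) (s₂ := {j, j + 1})
    rw [hsum, h']
    omega

theorem exists_rowSum_max (x : Plane → ℕ) :
    ∃ d : ZMod 5, d ≠ 0 ∧ ∀ j, j ≠ 0 → rowSum x j ≤ rowSum x d := by
  obtain ⟨d, hd, hmax⟩ := Finset.exists_max_image (Finset.univ.erase (0 : ZMod 5)) (rowSum x)
    ⟨1, by decide⟩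
  exact ⟨d, Finset.ne_of_mem_erase hd, fun j hj => hmax j (Finset.mem_erase_of_ne_of_mem hj
    (Finset.mem_univ j))⟩

namespace Profile

variable {x : Plane → ℕ} {q m : ℕ}

theorem eq_zero_of_lt (P : Profile x q) (he : 3 * q < x (1, 0)) :
    x (0, 0) = 0 ∧ x (2, 0) = 0 := by
  constructor
  · by_contra h
    have : x (1, 0) + x (1, 0) ≤ 5 * q := P.pair (0, 0) (1, 0) (Nat.pos_of_ne_zero h)
    omega
  · by_contra h
    have := P.pairSum (1, 0) (1, 0) (Nat.pos_of_ne_zero h)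
    omega

theorem add_le_of_adjacent (P : Profile x q) (he : m * q < x (1, 0)) {i j : ZMod 5}
    (h1 : 0 < x (i, j)) (h2 : 0 < x (i + 1, j)) : x (i, j) + x (i + 1, j) ≤ (5 - m) * q := by
  have hij : (1, 0) + (i, j) = (i + 1, j) := by simp [add_comm]
  have := P.triple (1, 0) (i, j) m (by omega) h1 (by rwa [hij]) he
  rw [hij] at this
  rw [Nat.sub_mul]
  omega

theorem normalized (P : Profile x q) (hle : ∀ g, x g ≤ (m + 1) * q) (he : m * q < x (1, 0))
    {d : ZMod 5} (hd : d ≠ 0) (hmax : ∀ j, j ≠ 0 → rowSum x j ≤ rowSum x d) (c : ZMod 5) :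
    NormalizedProfile (x ∘ triangular one_ne_zero c hd) q m where
  toProfile := P.comp _
  le_mul g := hle _
  mul_lt := by simpa [triangular_apply] using he
  rowSum_le j hj := by
    rw [rowSum_comp_triangular, rowSum_comp_triangular, mul_one]
    exact hmax _ (mul_ne_zero hd hj)

theorem row_cases (P : Profile x q) (hm : 3 ≤ m) (hle : ∀ g, x g ≤ (m + 1) * q)
    (he : m * q < x (1, 0)) {d : ZMod 5} (hd : d ≠ 0)
    (hmax : ∀ j, j ≠ 0 → rowSum x j ≤ rowSum x d) {T U : CaseTree}
    (hT : T.check m [(1, 0), (1, 1), (4, 1)] [0, (2, 0), (0, 1), (2, 1), (3, 1)])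
    (hU : U.check m [(1, 0), (0, 1), (2, 1), (3, 1)] [0, (2, 0), (1, 1), (4, 1)]) :
    IsExceptional x ∨ (∃ c, ∀ i, 0 < x (i, d) ↔ i = c) ∨ rowSum x d ≤ 2 * ((5 - m) * q) ∨
      ∀ i, x (i, d) + x (i + 1, d) ≤ (5 - m) * q := by
  have hz := P.eq_zero_of_lt ((Nat.mul_le_mul_right q hm).trans_lt he)
  have hpos : 0 < x (1, 0) := (Nat.zero_le _).trans_lt he
  rcases cycle_cases (fun i => x (i, d)) _ fun i => P.add_le_of_adjacent he with
    h | ⟨c, hc⟩ | ⟨c, hc⟩ | h | h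
  · exact .inr (.inl h)
  · refine .inl ((P.normalized hle he hd hmax c).isExceptional_of_check T _ _ ?_ ?_ hT).of_comp
    · simp [triangular_apply, hc, hpos]
    · have hc₀ : ∀ k, x (k, d) = 0 ↔ ¬(k = 1 + c ∨ k = 4 + c) := fun k => by
        rw [← hc, Nat.pos_iff_ne_zero, not_not]
      simp +decide [triangular_apply, hz, hc₀]
  · refine .inl ((P.normalized hle he hd hmax c).isExceptional_of_check U _ _ ?_ ?_ hU).of_comp
    · simp [triangular_apply, hc, hpos]
    · have hc₀ : ∀ k, x (k, d) = 0 ↔ ¬(k = c ∨ k = 2 + c ∨ k = 3 + c) := fun k => by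
        rw [← hc, Nat.pos_iff_ne_zero, not_not]
      simp +decide [triangular_apply, hz, hc₀]
  · exact .inr (.inr (.inl h))
  · exact .inr (.inr (.inr h))

end Profile

/-! ### Certificates -/

/-- A certificate, found by linear programming, for a weight at `(1, 0)` above `4 * q` and exactly
one positive weight at height `1`. -/
def singleTree : CaseTree :=
  .split (4, 4)
   (.leaf 2 [
     (1, .reflect (3, 0)), (2, .pair (0, 1) (1, 4)), (8, .pair (4, 4) (0, 1)), (2, .row 2),
     (2, .row 3), (2, .row 4)])
   (.split (4, 0)
    (.split (0, 2)
     (.leaf 1 [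
       (1, .pair (0, 2) (4, 3)), (1, .sum (1, 0) (3, 0)), (2, .sum (0, 1) (0, 1)),
       (1, .row 2), (1, .row 3), (1, .row 4)])
     (.split (3, 0)
      (.leaf 1 [
        (1, .shift (3, 0)), (1, .pair (3, 0) (1, 0)), (1, .row 2), (1, .row 3), (1, .row 4),
        (4, .point (0, 1))])
      (.split (0, 3)
       (.leaf 2 [
         (1, .pair (0, 3) (1, 0)), (1, .pair (0, 3) (4, 0)), (1, .pair (0, 3) (0, 1)),
         (2, .pair (0, 3) (0, 3)), (1, .sum (0, 1) (1, 4)), (1, .line (1, 1) (4, 0)),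
         (1, .line (4, 1) (1, 0)), (2, .row 2), (1, .row 3), (1, .row 4)])
       (.split (3, 3)
        (.leaf 2 [
          (1, .pair (3, 3) (1, 0)), (2, .sum (0, 1) (1, 4)), (1, .sum (0, 1) (3, 2)),
          (1, .dir (3, 3) (4, 0)), (1, .line (4, 1) (1, 0)), (1, .line (4, 1) (4, 0)),
          (1, .row 2), (1, .row 3), (1, .row 4)])
        (.split (2, 2)
         (.leaf 2 [
           (1, .pair (2, 2) (1, 0)), (1, .pair (2, 2) (4, 3)), (3, .sum (0, 1) (1, 4)),
           (1, .dir (2, 2) (4, 0)), (1, .line (4, 1) (1, 0)), (1, .line (4, 1) (4, 0)),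
           (1, .row 2), (1, .row 3), (1, .row 4)])
         (.split (1, 3)
          (.leaf 1 [
            (1, .pair (1, 3) (3, 2)), (2, .sum (0, 1) (1, 2)), (1, .line (4, 1) (1, 0)),
            (1, .row 3), (1, .row 4)])
          (.split (3, 2)
           (.leaf 3 [
             (2, .sum (0, 1) (1, 4)), (1, .sum (4, 0) (4, 2)), (2, .line (1, 1) (1, 0)),
             (2, .line (1, 1) (4, 0)), (2, .dir (3, 2) (1, 0)), (1, .row 2), (1, .row 3),
             (1, .row 4)])
           (.leaf 1 [
             (1, .pair (0, 1) (4, 2)), (1, .pair (0, 1) (1, 4)), (1, .line (1, 1) (4, 0)),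
             (1, .row 4), (1, .point (0, 1))]))))))))
    (.leaf 2 [
      (1, .reflect (3, 0)), (2, .row 2), (2, .row 3), (2, .row 4), (2, .point (1, 0)),
      (8, .point (0, 1))]))

/-- A certificate, found by linear programming, for a weight at `(1, 0)` above `4 * q` and positive
weights at `(0, 1)`, `(2, 1)` and `(3, 1)` only at height `1`. -/
def tripleTree : CaseTree :=
  .split (4, 2)
   (.split (3, 0)
    (.leaf 2 [
      (1, .reflect (3, 0)), (4, .shift (2, 1)), (2, .pair (3, 0) (1, 0)),
      (4, .pair (3, 0) (0, 1)), (4, .pair (3, 0) (2, 1)), (2, .row 2), (2, .row 3),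
      (2, .row 4)])
    (.split (1, 2)
     (.split (0, 3)
      (.leaf 10 [
        (28, .shift (2, 1)), (9, .reflect (1, 2)), (3, .pair (0, 1) (0, 1)),
        (3, .pair (2, 1) (0, 1)), (3, .pair (3, 1) (0, 1)), (9, .pair (1, 2) (0, 1)),
        (8, .pair (1, 2) (3, 3)), (9, .pair (4, 2) (0, 1)), (9, .pair (4, 2) (2, 3)),
        (2, .pair (0, 3) (4, 2)), (1, .line (4, 1) (1, 0)), (7, .row 2), (1, .row 3),
        (10, .row 4)])
      (.leaf 6 [
        (17, .shift (2, 1)), (1, .pair (0, 1) (0, 1)), (1, .pair (2, 1) (0, 1)),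
        (1, .pair (3, 1) (0, 1)), (6, .pair (1, 2) (0, 1)), (5, .pair (1, 2) (3, 3)),
        (6, .pair (4, 2) (0, 1)), (5, .pair (4, 2) (2, 3)), (1, .line (1, 1) (4, 0)),
        (1, .line (4, 1) (1, 0)), (5, .row 2), (6, .row 4)]))
     (.split (3, 2)
      (.leaf 2 [
        (5, .shift (2, 1)), (2, .shift (3, 2)), (2, .pair (0, 1) (0, 1)),
        (2, .pair (2, 1) (0, 1)), (1, .pair (3, 2) (1, 3)), (1, .pair (3, 2) (3, 3)),
        (1, .pair (4, 2) (0, 1)), (1, .pair (4, 2) (0, 3)), (1, .pair (4, 2) (2, 3)),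
        (1, .row 3), (2, .row 4)])
      (.split (0, 2)
       (.leaf 1 [
         (3, .shift (2, 1)), (1, .sum (4, 0) (3, 1)), (1, .sum (1, 0) (2, 1)),
         (2, .sum (0, 1) (0, 1)), (1, .row 2), (1, .row 3), (1, .row 4)])
       (.split (2, 3)
        (.leaf 1 [
          (2, .shift (2, 1)), (1, .reflect (4, 2)), (1, .pair (2, 1) (0, 1)),
          (1, .pair (4, 2) (0, 1)), (1, .pair (4, 2) (0, 3)), (1, .pair (2, 3) (1, 0)),
          (1, .sum (1, 0) (1, 3)), (1, .row 4)])
        (.leaf 3 [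
          (6, .shift (2, 1)), (3, .pair (2, 1) (0, 1)), (2, .pair (2, 1) (4, 2)),
          (1, .pair (2, 1) (3, 3)), (1, .pair (2, 1) (4, 4)), (1, .pair (3, 1) (1, 4)),
          (1, .pair (3, 1) (3, 4)), (2, .pair (4, 2) (0, 1)), (2, .pair (4, 2) (0, 3)),
          (1, .line (4, 1) (1, 0)), (1, .row 3), (2, .row 4)]))))))
   (.split (1, 2)
    (.split (0, 2)
     (.leaf 2 [
       (1, .reflect (3, 0)), (6, .shift (2, 1)), (2, .sum (4, 0) (3, 1)),
       (2, .sum (1, 0) (2, 1)), (4, .sum (0, 1) (0, 1)), (2, .row 2), (2, .row 3),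
       (2, .row 4)])
     (.split (3, 0)
      (.leaf 6 [
        (3, .reflect (3, 0)), (16, .shift (2, 1)), (6, .pair (3, 0) (1, 0)),
        (8, .pair (2, 1) (0, 1)), (2, .pair (2, 1) (1, 2)), (6, .pair (3, 1) (0, 1)),
        (2, .pair (3, 1) (1, 2)), (2, .pair (1, 2) (0, 1)), (2, .pair (1, 2) (0, 3)),
        (2, .sum (1, 2) (2, 3)), (4, .row 3), (6, .row 4)])
      (.split (2, 2)
       (.leaf 1 [
         (2, .shift (2, 1)), (1, .shift (1, 2)), (1, .pair (1, 2) (0, 1)),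
         (1, .pair (1, 2) (0, 3)), (1, .pair (1, 2) (3, 3)), (1, .pair (2, 2) (1, 0)),
         (1, .pair (2, 2) (0, 1)), (1, .pair (2, 2) (4, 3)), (1, .row 4)])
       (.split (3, 3)
        (.leaf 3 [
          (8, .shift (2, 1)), (3, .pair (3, 1) (0, 1)), (1, .pair (1, 2) (0, 1)),
          (1, .pair (1, 2) (0, 3)), (1, .pair (3, 3) (1, 0)), (3, .dir (3, 3) (4, 0)),
          (1, .line (4, 1) (1, 0)), (2, .row 3), (3, .row 4)])
        (.leaf 6 [
          (12, .shift (2, 1)), (6, .pair (3, 1) (0, 1)), (2, .pair (3, 1) (1, 2)),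
          (4, .pair (1, 2) (0, 1)), (4, .pair (1, 2) (0, 3)), (2, .sum (4, 0) (3, 1)),
          (2, .sum (1, 0) (2, 1)), (1, .sum (4, 3) (4, 3)), (4, .line (1, 1) (4, 0)),
          (2, .row 3), (6, .row 4)])))))
    (.leaf 2 [
      (1, .reflect (3, 0)), (4, .shift (2, 1)), (2, .pair (0, 1) (0, 1)),
      (2, .pair (2, 1) (1, 0)), (2, .pair (2, 1) (0, 1)), (2, .pair (3, 1) (4, 0)),
      (2, .pair (3, 1) (0, 1)), (2, .row 3), (2, .row 4)]))

/-- A certificate, found by linear programming, for a weight at `(1, 0)` above `4 * q` and positive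
weights at `(1, 1)` and `(4, 1)` only at height `1`. -/
def doubleTree : CaseTree :=
  .split (0, 4)
   (.leaf 2 [
     (1, .reflect (3, 0)), (6, .reflect (1, 1)), (2, .pair (0, 4) (1, 0)),
     (2, .pair (0, 4) (4, 1)), (2, .sum (4, 1) (2, 4)), (2, .sum (1, 0) (4, 4)),
     (2, .line (3, 1) (1, 0)), (2, .row 2), (2, .row 3)])
   (.split (3, 0)
    (.leaf 2 [
      (1, .reflect (3, 0)), (2, .pair (3, 0) (1, 0)), (8, .pair (3, 0) (1, 1)), (2, .row 2),
      (2, .row 3), (2, .row 4)])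
    (.split (0, 2)
     (.split (2, 2)
      (.split (3, 2)
       (.leaf 1 [
         (1, .shift (2, 2)), (1, .pair (2, 2) (4, 0)), (1, .pair (3, 2) (1, 0)),
         (1, .sum (1, 1) (1, 1)), (1, .sum (4, 1) (4, 1)), (1, .triple (1, 1) (4, 1)),
         (1, .row 3), (1, .row 4)])
       (.split (1, 2)
        (.leaf 1 [
          (1, .shift (0, 2)), (1, .pair (1, 2) (1, 0)), (1, .pair (2, 2) (2, 3)),
          (1, .sum (1, 0) (4, 2)), (3, .sum (1, 1) (4, 1)), (1, .row 3), (1, .row 4)])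
        (.split (4, 2)
         (.leaf 2 [
           (2, .shift (4, 2)), (1, .pair (0, 2) (1, 3)), (1, .pair (0, 2) (4, 3)),
           (1, .pair (2, 2) (2, 3)), (1, .pair (4, 2) (4, 1)), (3, .sum (1, 1) (4, 1)),
           (1, .triple (1, 1) (1, 1)), (1, .line (3, 1) (1, 0)), (1, .row 3), (2, .row 4)])
         (.split (4, 4)
          (.leaf 5 [
            (1, .pair (1, 1) (0, 3)), (1, .pair (1, 1) (3, 4)), (2, .pair (4, 1) (2, 4)),
            (2, .pair (0, 2) (1, 3)), (2, .pair (0, 2) (4, 3)), (1, .pair (0, 2) (1, 4)),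
            (2, .pair (2, 2) (2, 3)), (1, .sum (3, 3) (3, 3)), (5, .sum (1, 1) (4, 1)),
            (5, .triple (1, 1) (4, 1)), (2, .triple (2, 2) (2, 2)),
            (1, .line (3, 1) (1, 0)), (3, .row 3), (3, .row 4)])
          (.leaf 2 [
            (1, .pair (1, 1) (2, 2)), (1, .pair (4, 1) (2, 4)), (1, .pair (0, 2) (4, 3)),
            (1, .pair (2, 2) (2, 3)), (1, .sum (1, 1) (4, 1)), (2, .triple (1, 1) (4, 1)),
            (1, .dir (0, 2) (1, 0)), (1, .line (3, 1) (1, 0)), (1, .row 3), (1, .row 4)])))))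
      (.split (3, 2)
       (.split (4, 2)
        (.leaf 1 [
          (1, .shift (4, 2)), (1, .pair (0, 2) (1, 0)), (1, .pair (0, 2) (4, 3)),
          (3, .sum (1, 1) (4, 1)), (1, .sum (1, 0) (3, 2)), (1, .row 3), (1, .row 4)])
        (.split (1, 2)
         (.leaf 7 [
           (7, .shift (0, 2)), (2, .pair (1, 1) (3, 4)), (3, .pair (0, 2) (4, 3)),
           (2, .pair (1, 2) (1, 1)), (2, .pair (1, 2) (3, 2)), (5, .pair (3, 2) (3, 3)),
           (11, .sum (1, 1) (4, 1)), (3, .triple (4, 1) (4, 1)), (2, .dir (0, 2) (1, 0)),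
           (2, .line (2, 1) (4, 0)), (5, .row 3), (5, .row 4)])
         (.split (1, 4)
          (.leaf 5 [
            (2, .pair (1, 1) (3, 4)), (1, .pair (4, 1) (2, 4)), (2, .pair (0, 2) (1, 3)),
            (2, .pair (3, 2) (3, 3)), (1, .sum (2, 3) (2, 3)), (4, .sum (1, 1) (4, 1)),
            (1, .sum (1, 1) (0, 3)), (5, .triple (1, 1) (4, 1)), (2, .triple (3, 2) (3, 2)),
            (2, .dir (0, 2) (4, 0)), (1, .line (2, 1) (4, 0)), (3, .row 3), (3, .row 4)])
          (.leaf 6 [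
            (1, .pair (1, 1) (3, 4)), (3, .pair (4, 1) (3, 2)), (1, .pair (4, 1) (0, 3)),
            (3, .pair (0, 2) (1, 3)), (3, .pair (0, 2) (4, 3)), (3, .pair (3, 2) (3, 3)),
            (6, .sum (1, 1) (4, 1)), (6, .triple (1, 1) (4, 1)), (1, .triple (4, 1) (4, 1)),
            (2, .line (2, 1) (4, 0)), (3, .row 3), (5, .row 4)]))))
       (.leaf 1 [
         (1, .pair (0, 2) (1, 0)), (1, .pair (0, 2) (4, 0)), (2, .sum (1, 1) (4, 1)),
         (1, .triple (1, 1) (4, 1)), (1, .row 3), (1, .row 4)])))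
     (.split (3, 2)
      (.split (2, 2)
       (.leaf 2 [
         (2, .shift (2, 2)), (2, .sum (1, 0) (1, 2)), (3, .sum (1, 1) (1, 1)),
         (2, .sum (4, 0) (4, 2)), (3, .sum (4, 1) (4, 1)), (2, .row 3), (2, .row 4)])
       (.split (3, 4)
        (.leaf 3 [
          (2, .pair (4, 1) (2, 4)), (3, .pair (3, 2) (1, 0)), (2, .pair (3, 2) (3, 4)),
          (2, .pair (3, 4) (1, 0)), (3, .pair (3, 4) (1, 1)), (1, .pair (3, 4) (1, 2)),
          (3, .triple (4, 1) (4, 1)), (2, .line (0, 1) (1, 0)), (3, .row 3), (1, .row 4)])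
        (.split (3, 3)
         (.leaf 3 [
           (3, .reflect (3, 2)), (2, .pair (1, 1) (0, 3)), (3, .pair (4, 1) (2, 4)),
           (3, .pair (3, 2) (1, 0)), (1, .pair (3, 2) (1, 3)), (2, .pair (3, 3) (1, 0)),
           (3, .pair (3, 3) (1, 1)), (2, .pair (3, 3) (1, 2)), (2, .sum (4, 1) (4, 1)),
           (2, .sum (1, 0) (2, 3)), (1, .line (0, 1) (1, 0)), (1, .row 3)])
         (.split (0, 3)
          (.leaf 6 [
            (2, .pair (4, 1) (3, 2)), (2, .pair (4, 1) (0, 3)), (4, .pair (4, 1) (2, 4)),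
            (2, .pair (3, 2) (1, 0)), (1, .sum (2, 3) (2, 3)), (2, .triple (4, 1) (4, 1)),
            (6, .dir (0, 3) (1, 0)), (4, .dir (0, 3) (4, 0)), (2, .line (2, 1) (4, 0)),
            (2, .row 3)])
          (.split (2, 3)
           (.split (1, 2)
            (.leaf 1 [
              (1, .pair (3, 2) (1, 0)), (1, .pair (3, 2) (1, 1)), (1, .pair (3, 2) (1, 3)),
              (1, .triple (1, 1) (1, 2)), (1, .triple (4, 1) (4, 1)), (1, .row 4)])
            (.split (4, 2)
             (.leaf 1 [
               (1, .shift (3, 2)), (2, .pair (3, 2) (1, 1)), (1, .pair (3, 2) (1, 3)),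
               (1, .pair (4, 2) (2, 3)), (1, .sum (4, 1) (4, 1)), (1, .row 4)])
             (.split (1, 4)
              (.split (1, 3)
               (.leaf 1 [
                 (1, .shift (1, 3)), (1, .pair (3, 2) (1, 4)), (1, .pair (1, 3) (1, 0)),
                 (1, .sum (4, 3) (4, 4)), (1, .dir (1, 3) (4, 0))])
               (.split (2, 4)
                (.leaf 1 [
                  (1, .pair (4, 1) (3, 2)), (2, .pair (3, 2) (1, 1)),
                  (2, .pair (2, 4) (4, 1)), (1, .sum (4, 0) (2, 4)), (1, .row 4)])
                (.split (4, 3)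
                 (.leaf 1 [
                   (1, .sum (4, 3) (4, 4)), (1, .sum (1, 1) (3, 2)),
                   (1, .triple (4, 1) (2, 3)), (1, .point (1, 0)), (1, .point (4, 0))])
                 (.exceptional 1 4 4))))
              (.leaf 1 [
                (1, .pair (4, 1) (2, 4)), (1, .pair (3, 2) (1, 1)),
                (1, .pair (3, 2) (1, 3)), (1, .sum (4, 3) (4, 4)),
                (1, .triple (4, 1) (3, 2))]))))
           (.leaf 2 [
             (1, .pair (4, 1) (2, 4)), (1, .pair (3, 2) (1, 0)), (2, .pair (3, 2) (1, 1)),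
             (1, .pair (3, 2) (1, 2)), (1, .pair (3, 2) (1, 3)), (1, .sum (4, 0) (4, 2)),
             (2, .triple (4, 1) (4, 1)), (1, .line (0, 1) (1, 0)), (1, .row 4)]))))))
      (.split (2, 3)
       (.split (2, 4)
        (.leaf 1 [
          (1, .pair (1, 1) (1, 1)), (1, .pair (1, 1) (3, 4)), (3, .pair (2, 4) (4, 1)),
          (1, .pair (2, 4) (4, 2)), (1, .sum (1, 1) (1, 2)), (1, .row 3), (1, .row 4)])
        (.split (2, 2)
         (.split (4, 4)
          (.leaf 4 [
            (2, .pair (2, 2) (2, 3)), (2, .pair (2, 2) (4, 3)), (2, .pair (2, 2) (4, 4)),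
            (2, .pair (2, 3) (1, 0)), (4, .pair (2, 3) (4, 1)), (2, .pair (2, 3) (2, 2)),
            (4, .pair (2, 3) (4, 2)), (4, .sum (1, 0) (1, 2)), (1, .sum (1, 1) (1, 1)),
            (2, .sum (1, 0) (1, 3)), (4, .sum (1, 0) (3, 4)), (2, .sum (4, 1) (0, 3)),
            (2, .triple (2, 2) (4, 4)), (2, .row 3)])
          (.leaf 1 [
            (1, .pair (1, 1) (3, 4)), (2, .pair (2, 3) (4, 1)), (1, .pair (2, 3) (4, 2)),
            (1, .sum (1, 0) (1, 2)), (1, .triple (1, 1) (1, 1)), (1, .row 3)]))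
         (.split (0, 3)
          (.leaf 5 [
            (2, .pair (2, 3) (1, 0)), (3, .pair (2, 3) (1, 1)), (1, .triple (2, 3) (2, 3)),
            (5, .dir (0, 3) (1, 0)), (5, .dir (0, 3) (4, 0)), (2, .line (3, 1) (1, 0)),
            (3, .row 3)])
          (.split (3, 4)
           (.leaf 1 [
             (1, .pair (2, 3) (4, 1)), (1, .pair (2, 3) (4, 2)), (1, .pair (3, 4) (1, 0)),
             (1, .pair (3, 4) (1, 1)), (1, .pair (3, 4) (1, 2)), (1, .triple (1, 1) (2, 3)),
             (1, .row 3)])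
           (.leaf 6 [
             (4, .pair (2, 3) (1, 0)), (2, .pair (2, 3) (4, 2)), (2, .pair (2, 3) (4, 3)),
             (1, .pair (2, 3) (4, 4)), (1, .sum (1, 0) (1, 3)), (2, .sum (4, 0) (3, 3)),
             (3, .triple (2, 3) (2, 3)), (5, .line (0, 1) (1, 0)), (4, .line (0, 1) (4, 0)),
             (1, .row 4)])))))
       (.split (3, 3)
        (.split (2, 4)
         (.leaf 1 [
           (1, .reflect (4, 1)), (1, .pair (1, 1) (3, 4)), (3, .pair (3, 3) (1, 1)),
           (2, .pair (2, 4) (4, 1)), (1, .sum (1, 0) (1, 4)), (1, .row 2), (1, .row 3)])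
         (.split (0, 3)
          (.leaf 8 [
            (3, .pair (1, 1) (1, 1)), (2, .pair (0, 3) (1, 2)), (2, .pair (0, 3) (4, 2)),
            (3, .triple (3, 3) (3, 3)), (6, .dir (0, 3) (1, 0)), (6, .dir (0, 3) (4, 0)),
            (6, .line (3, 1) (1, 0)), (2, .row 3), (2, .row 4)])
          (.split (2, 2)
           (.split (1, 2)
            (.leaf 1 [
              (1, .shift (1, 2)), (1, .pair (1, 2) (3, 3)), (1, .pair (2, 2) (4, 1)),
              (1, .pair (2, 2) (4, 3)), (1, .sum (1, 1) (1, 1)), (1, .sum (4, 1) (4, 2)),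
              (1, .row 4)])
            (.split (4, 4)
             (.split (3, 4)
              (.leaf 1 [
                (1, .shift (3, 4)), (1, .pair (1, 1) (2, 2)), (1, .pair (2, 2) (4, 1)),
                (1, .pair (2, 2) (4, 2)), (1, .pair (2, 2) (4, 3)),
                (1, .pair (3, 4) (1, 1))])
              (.split (4, 2)
               (.leaf 1 [
                 (1, .pair (2, 2) (4, 3)), (1, .sum (1, 3) (1, 4)), (1, .sum (4, 0) (4, 3)),
                 (1, .triple (4, 1) (4, 2)), (1, .triple (2, 2) (4, 4))])
               (.split (4, 3)
                (.leaf 1 [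
                  (1, .reflect (2, 2)), (1, .pair (2, 2) (4, 1)), (1, .pair (2, 2) (4, 4)),
                  (1, .pair (4, 3) (2, 2)), (1, .dir (4, 3) (4, 0))])
                (.split (1, 3)
                 (.leaf 1 [
                   (1, .pair (1, 3) (3, 3)), (1, .triple (1, 1) (1, 1)),
                   (1, .triple (4, 1) (2, 2)), (1, .row 4), (1, .point (1, 0)),
                   (1, .point (4, 0))])
                 (.exceptional 1 4 1)))))
             (.leaf 1 [
               (1, .pair (1, 1) (3, 4)), (1, .pair (2, 2) (4, 1)), (1, .pair (2, 2) (4, 2)),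
               (1, .pair (2, 2) (4, 3)), (1, .triple (1, 1) (2, 2))])))
           (.leaf 2 [
             (1, .pair (1, 1) (3, 4)), (2, .pair (3, 3) (1, 0)), (1, .pair (3, 3) (1, 1)),
             (1, .pair (3, 3) (1, 2)), (1, .pair (3, 3) (1, 3)), (2, .sum (4, 1) (4, 2)),
             (1, .triple (3, 3) (3, 3)), (1, .line (0, 1) (1, 0)), (1, .row 4)]))))
        (.split (0, 3)
         (.leaf 4 [
           (1, .pair (1, 1) (1, 1)), (1, .pair (4, 1) (0, 3)), (3, .pair (4, 1) (2, 4)),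
           (2, .pair (0, 3) (4, 2)), (2, .sum (1, 0) (4, 3)), (4, .dir (0, 3) (1, 0)),
           (2, .dir (0, 3) (4, 0)), (3, .line (3, 1) (1, 0)), (1, .row 4)])
         (.split (2, 2)
          (.leaf 7 [
            (4, .pair (1, 1) (3, 4)), (3, .pair (4, 1) (2, 4)), (9, .pair (2, 2) (4, 1)),
            (3, .pair (2, 2) (4, 2)), (4, .pair (2, 2) (4, 3)), (6, .sum (1, 0) (1, 2)),
            (6, .triple (1, 1) (1, 1)), (3, .line (0, 1) (4, 0)), (1, .row 2), (4, .row 4)])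
          (.split (3, 4)
           (.leaf 2 [
             (1, .pair (4, 1) (2, 4)), (1, .pair (3, 4) (1, 0)), (2, .pair (3, 4) (1, 1)),
             (1, .pair (3, 4) (1, 2)), (1, .pair (3, 4) (3, 4)), (2, .sum (4, 1) (4, 3)),
             (1, .sum (4, 2) (4, 2)), (1, .line (0, 1) (1, 0)), (1, .row 4)])
           (.leaf 1 [(1, .pair (4, 1) (2, 4)), (1, .line (0, 1) (1, 0)),
             (1, .line (0, 1) (4, 0))])))))))))

/-- The analogue of `tripleTree` for a maximal weight at `(1, 0)` between `3 * q` and `4 * q`. -/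
def sparseTripleTree : CaseTree :=
  .split (1, 4)
   (.leaf 2 [
     (1, .reflect (3, 0)), (8, .shift (2, 1)), (8, .pair (1, 4) (0, 1)),
     (2, .pair (1, 4) (3, 1)), (2, .row 2), (2, .row 3), (2, .row 4)])
   (.split (0, 2)
    (.leaf 2 [
      (1, .reflect (3, 0)), (5, .shift (2, 1)), (1, .pair (3, 1) (4, 0)),
      (1, .sum (4, 0) (3, 1)), (4, .sum (0, 1) (0, 1)), (2, .triple (1, 0) (2, 1)),
      (2, .row 2), (2, .row 3), (2, .row 4)])
    (.split (4, 4)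
     (.split (3, 2)
      (.split (3, 4)
       (.leaf 4 [
         (2, .reflect (3, 0)), (7, .shift (2, 1)), (4, .reflect (2, 1)),
         (4, .reflect (3, 1)), (1, .pair (2, 1) (0, 1)), (1, .pair (3, 1) (0, 1)),
         (3, .pair (3, 2) (2, 4)), (4, .pair (4, 4) (1, 0)), (4, .pair (4, 4) (0, 1)),
         (1, .pair (4, 4) (1, 2)), (1, .dir (3, 2) (1, 0)), (3, .row 2), (4, .row 3)])
       (.leaf 2 [
         (1, .reflect (3, 0)), (4, .shift (2, 1)), (2, .reflect (2, 1)),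
         (2, .pair (3, 2) (2, 4)), (2, .pair (4, 4) (1, 0)), (2, .pair (4, 4) (0, 1)),
         (2, .sum (0, 1) (3, 1)), (2, .row 2), (2, .row 3)]))
      (.split (3, 4)
       (.leaf 6 [
         (3, .reflect (3, 0)), (8, .shift (2, 1)), (6, .reflect (2, 1)),
         (6, .reflect (3, 1)), (4, .pair (2, 1) (0, 1)), (6, .pair (4, 4) (1, 0)),
         (6, .pair (4, 4) (0, 1)), (4, .pair (4, 4) (1, 2)), (6, .sum (1, 0) (2, 4)),
         (2, .sum (4, 2) (4, 2)), (2, .row 2), (6, .row 3)])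
       (.split (0, 4)
        (.leaf 10 [
          (5, .reflect (3, 0)), (24, .shift (2, 1)), (6, .shift (4, 4)),
          (6, .pair (2, 1) (0, 1)), (10, .pair (4, 4) (0, 1)), (6, .pair (4, 4) (1, 2)),
          (4, .triple (1, 0) (2, 1)), (6, .line (4, 1) (1, 0)), (4, .row 2), (10, .row 3),
          (4, .row 4)])
        (.leaf 10 [
          (5, .reflect (3, 0)), (24, .shift (2, 1)), (6, .pair (2, 1) (0, 1)),
          (10, .pair (2, 1) (4, 4)), (10, .pair (4, 4) (0, 1)), (2, .pair (4, 4) (1, 2)),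
          (4, .sum (1, 2) (2, 4)), (6, .line (4, 1) (1, 0)), (4, .row 2), (10, .row 3)]))))
     (.split (4, 2)
      (.split (3, 0)
       (.split (3, 2)
        (.split (4, 0)
         (.split (2, 2)
          (.leaf 14 [
            (14, .shift (3, 0)), (32, .shift (2, 1)), (12, .shift (3, 2)),
            (2, .pair (0, 1) (0, 3)), (14, .pair (2, 1) (0, 1)), (2, .pair (2, 2) (0, 1)),
            (8, .pair (2, 2) (3, 4)), (6, .pair (3, 2) (2, 4)), (4, .pair (4, 2) (1, 2)),
            (1, .sum (1, 3) (1, 3)), (10, .sum (1, 0) (1, 2)), (2, .dir (2, 2) (1, 0)),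
            (2, .dir (3, 2) (1, 0)), (12, .row 3), (6, .row 4)])
          (.leaf 1 [
            (1, .shift (3, 0)), (2, .shift (2, 1)), (1, .pair (3, 2) (2, 4)),
            (1, .pair (4, 2) (1, 2)), (1, .sum (0, 1) (3, 4)), (1, .triple (1, 0) (3, 2)),
            (1, .row 3)]))
         (.leaf 2 [
           (1, .reflect (3, 0)), (4, .shift (2, 1)), (2, .shift (3, 2)),
           (2, .pair (3, 2) (2, 4)), (2, .pair (4, 2) (1, 2)), (2, .sum (0, 1) (3, 4)),
           (2, .sum (1, 0) (2, 2)), (2, .row 3)]))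
        (.split (0, 4)
         (.split (1, 2)
          (.split (3, 4)
           (.leaf 2 [
             (1, .reflect (3, 0)), (2, .shift (2, 1)), (2, .reflect (3, 1)),
             (2, .pair (3, 0) (1, 0)), (2, .pair (3, 0) (2, 1)), (2, .pair (2, 1) (0, 1)),
             (2, .sum (1, 0) (2, 4)), (2, .triple (1, 2) (4, 2)), (2, .row 3)])
           (.leaf 10 [
             (5, .reflect (3, 0)), (18, .shift (2, 1)), (8, .pair (3, 0) (1, 0)),
             (2, .pair (3, 0) (2, 4)), (2, .pair (0, 1) (2, 3)), (10, .pair (2, 1) (0, 1)),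
             (2, .pair (2, 1) (2, 4)), (2, .pair (1, 2) (0, 1)), (2, .pair (1, 2) (1, 2)),
             (2, .pair (4, 2) (0, 1)), (2, .sum (0, 1) (0, 3)), (8, .triple (1, 2) (4, 2)),
             (2, .line (4, 1) (1, 0)), (8, .row 3)]))
          (.split (3, 4)
           (.leaf 2 [
             (4, .shift (2, 1)), (2, .pair (3, 0) (1, 0)), (2, .pair (3, 0) (0, 1)),
             (2, .pair (2, 1) (0, 1)), (1, .sum (4, 2) (4, 2)), (2, .triple (3, 0) (2, 1)),
             (2, .row 3), (2, .row 4)])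
           (.leaf 6 [
             (3, .reflect (3, 0)), (10, .shift (2, 1)), (6, .pair (3, 0) (1, 0)),
             (4, .pair (3, 0) (2, 4)), (4, .pair (2, 1) (0, 1)), (2, .pair (2, 1) (4, 2)),
             (2, .pair (3, 1) (4, 2)), (2, .pair (4, 2) (0, 1)), (2, .sum (2, 2) (0, 4)),
             (2, .sum (0, 1) (0, 3)), (2, .line (4, 1) (1, 0)), (4, .row 3)])))
         (.leaf 8 [
           (3, .reflect (3, 0)), (18, .shift (2, 1)), (8, .pair (3, 0) (1, 0)),
           (2, .pair (3, 0) (0, 1)), (4, .pair (2, 1) (0, 1)), (8, .sum (0, 1) (3, 4)),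
           (4, .sum (1, 2) (2, 4)), (2, .triple (3, 0) (2, 1)), (4, .line (4, 1) (1, 0)),
           (4, .row 2), (8, .row 3)])))
       (.split (3, 2)
        (.split (0, 3)
         (.leaf 1 [
           (2, .shift (2, 1)), (1, .shift (3, 2)), (1, .pair (3, 1) (3, 4)),
           (1, .pair (3, 2) (4, 0)), (1, .pair (3, 2) (2, 4)), (1, .pair (0, 3) (0, 1)),
           (1, .pair (0, 3) (1, 2)), (1, .row 3)])
         (.split (2, 2)
          (.leaf 6 [
            (8, .shift (2, 1)), (4, .shift (2, 2)), (2, .shift (3, 2)),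
            (2, .pair (4, 2) (0, 1)), (1, .sum (1, 3) (1, 3)), (2, .sum (1, 0) (1, 2)),
            (2, .dir (2, 2) (1, 0)), (4, .dir (2, 2) (4, 0)), (4, .dir (3, 2) (1, 0)),
            (2, .dir (3, 2) (4, 0)), (2, .row 3), (2, .row 4)])
          (.split (2, 4)
           (.leaf 2 [
             (3, .shift (2, 1)), (1, .shift (3, 2)), (1, .pair (3, 1) (3, 4)),
             (1, .pair (3, 2) (1, 3)), (1, .pair (4, 2) (0, 1)), (2, .pair (4, 2) (1, 2)),
             (1, .pair (4, 2) (2, 3)), (1, .sum (4, 0) (3, 4)), (1, .triple (3, 2) (2, 4)),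
             (1, .dir (3, 2) (1, 0)), (1, .row 3)])
           (.leaf 3 [
             (4, .shift (2, 1)), (3, .shift (3, 2)), (3, .pair (3, 1) (3, 4)),
             (2, .pair (3, 2) (0, 1)), (3, .pair (3, 2) (1, 3)), (2, .pair (4, 2) (0, 1)),
             (3, .pair (4, 2) (1, 2)), (2, .pair (4, 2) (2, 3)), (1, .row 3)]))))
        (.split (2, 3)
         (.split (2, 2)
          (.leaf 2 [
            (3, .shift (2, 1)), (1, .reflect (4, 2)), (1, .pair (2, 2) (3, 4)),
            (1, .pair (4, 2) (0, 1)), (1, .pair (4, 2) (0, 3)), (2, .sum (1, 0) (1, 2)),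
            (1, .triple (0, 1) (2, 1)), (1, .dir (2, 3) (1, 0)), (1, .dir (2, 3) (4, 0)),
            (1, .row 3), (1, .row 4)])
          (.leaf 2 [
            (3, .shift (2, 1)), (1, .reflect (4, 2)), (2, .pair (3, 1) (3, 4)),
            (1, .pair (4, 2) (0, 1)), (2, .pair (4, 2) (1, 2)), (1, .pair (4, 2) (0, 3)),
            (1, .pair (2, 3) (4, 0)), (1, .pair (2, 3) (0, 1)), (1, .dir (2, 3) (1, 0)),
            (1, .row 3)]))
         (.split (0, 3)
          (.split (4, 3)
           (.leaf 3 [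
             (7, .shift (2, 1)), (3, .pair (2, 1) (0, 1)), (2, .pair (2, 1) (2, 4)),
             (2, .pair (3, 1) (3, 4)), (2, .pair (0, 3) (0, 1)), (3, .pair (0, 3) (1, 2)),
             (1, .pair (0, 3) (4, 2)), (2, .sum (0, 1) (4, 2)), (3, .row 3), (1, .row 4)])
           (.leaf 9 [
             (19, .shift (2, 1)), (9, .pair (2, 1) (0, 1)), (4, .pair (3, 1) (3, 4)),
             (4, .pair (0, 3) (0, 1)), (9, .pair (0, 3) (1, 2)), (5, .pair (0, 3) (4, 2)),
             (4, .sum (4, 0) (1, 3)), (2, .triple (0, 3) (0, 3)), (4, .line (4, 1) (1, 0)),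
             (5, .row 3), (5, .row 4)]))
          (.split (4, 3)
           (.leaf 2 [
             (4, .shift (2, 1)), (1, .pair (2, 1) (2, 4)), (1, .pair (3, 1) (3, 4)),
             (1, .pair (4, 2) (0, 1)), (1, .pair (4, 2) (1, 2)), (1, .pair (4, 3) (4, 0)),
             (1, .pair (4, 3) (2, 2)), (2, .pair (4, 3) (1, 3)), (1, .sum (1, 0) (3, 3)),
             (1, .triple (0, 1) (4, 2)), (1, .row 2), (1, .row 4)])
           (.split (1, 2)
            (.leaf 2 [
              (4, .shift (2, 1)), (1, .pair (2, 1) (0, 1)), (1, .pair (3, 1) (3, 4)),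
              (2, .pair (1, 2) (0, 1)), (2, .pair (1, 2) (3, 3)), (1, .pair (4, 2) (1, 2)),
              (1, .line (4, 1) (1, 0)), (1, .row 2), (1, .row 4)])
            (.leaf 1 [
              (1, .shift (2, 1)), (1, .pair (2, 1) (0, 1)), (1, .pair (2, 1) (4, 2)),
              (1, .pair (2, 1) (3, 3)), (1, .pair (2, 1) (2, 4)), (1, .pair (3, 1) (3, 4))])))))))
      (.split (2, 2)
       (.split (3, 0)
        (.leaf 4 [
          (1, .reflect (3, 0)), (10, .shift (2, 1)), (4, .pair (3, 0) (1, 0)),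
          (2, .pair (3, 0) (2, 1)), (4, .pair (2, 1) (0, 1)), (4, .pair (3, 1) (0, 1)),
          (4, .sum (1, 0) (1, 2)), (2, .triple (3, 0) (0, 1)), (4, .row 3), (4, .row 4)])
        (.split (3, 2)
         (.leaf 3 [
           (4, .shift (2, 1)), (2, .shift (2, 2)), (1, .pair (0, 1) (0, 3)),
           (1, .pair (3, 1) (3, 4)), (2, .pair (3, 2) (2, 4)), (1, .sum (1, 0) (1, 2)),
           (1, .dir (2, 2) (1, 0)), (2, .dir (2, 2) (4, 0)), (1, .dir (3, 2) (1, 0)),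
           (1, .dir (3, 2) (4, 0)), (2, .row 3)])
         (.leaf 6 [
           (12, .shift (2, 1)), (2, .pair (0, 1) (0, 3)), (6, .pair (2, 1) (0, 1)),
           (2, .pair (2, 1) (3, 3)), (4, .pair (2, 1) (2, 4)), (2, .pair (2, 2) (4, 3)),
           (2, .pair (2, 2) (3, 4)), (1, .sum (1, 3) (1, 3)), (4, .sum (1, 0) (1, 2)),
           (2, .dir (2, 2) (4, 0)), (4, .row 3), (2, .row 4), (2, .point (0, 1))])))
       (.split (3, 0)
        (.split (2, 4)
         (.leaf 2 [
           (1, .reflect (3, 0)), (4, .shift (2, 1)), (2, .pair (3, 0) (1, 0)),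
           (2, .pair (3, 0) (2, 4)), (2, .pair (3, 1) (0, 1)), (2, .sum (0, 1) (3, 4)),
           (1, .sum (1, 2) (1, 2)), (2, .row 3)])
         (.leaf 6 [
           (3, .reflect (3, 0)), (10, .shift (2, 1)), (6, .pair (3, 0) (1, 0)),
           (2, .pair (3, 0) (3, 2)), (2, .pair (0, 1) (1, 2)), (2, .pair (0, 1) (0, 3)),
           (2, .pair (2, 1) (3, 3)), (4, .pair (3, 1) (0, 1)), (2, .pair (3, 1) (1, 2)),
           (2, .pair (3, 1) (2, 3)), (6, .sum (0, 1) (3, 4)), (4, .row 3)]))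
        (.split (0, 3)
         (.leaf 1 [
           (2, .shift (2, 1)), (1, .pair (2, 1) (2, 4)), (1, .pair (3, 1) (0, 1)),
           (1, .pair (3, 1) (3, 4)), (1, .pair (0, 3) (0, 1)), (1, .pair (0, 3) (1, 2)),
           (1, .row 3)])
         (.split (1, 3)
          (.leaf 4 [
            (8, .shift (2, 1)), (2, .pair (2, 1) (3, 3)), (2, .pair (2, 1) (2, 4)),
            (2, .pair (3, 1) (0, 1)), (2, .pair (3, 1) (3, 4)), (2, .pair (1, 3) (1, 0)),
            (2, .pair (1, 3) (3, 2)), (2, .pair (1, 3) (4, 3)), (1, .sum (1, 3) (1, 3)),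
            (4, .sum (0, 1) (1, 2)), (2, .row 3), (2, .row 4)])
          (.split (3, 3)
           (.leaf 2 [
             (3, .shift (2, 1)), (1, .pair (2, 1) (3, 3)), (2, .pair (3, 3) (1, 0)),
             (2, .pair (3, 3) (3, 2)), (2, .dir (3, 3) (4, 0)), (1, .line (4, 1) (1, 0)),
             (1, .row 4)])
           (.leaf 1 [
             (1, .shift (2, 1)), (1, .pair (2, 1) (2, 4)), (1, .pair (3, 1) (0, 1)),
             (1, .pair (3, 1) (1, 2)), (1, .pair (3, 1) (2, 3)), (1, .pair (3, 1) (3, 4))])))))))))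

/-- The analogue of `doubleTree` for a maximal weight at `(1, 0)` between `3 * q` and `4 * q`. -/
def sparseDoubleTree : CaseTree :=
  .split (3, 0)
   (.leaf 1 [
     (1, .pair (3, 0) (1, 0)), (3, .pair (3, 0) (1, 1)), (1, .triple (3, 0) (1, 1)),
     (1, .row 2), (1, .row 3), (1, .row 4)])
   (.split (0, 4)
    (.leaf 1 [
      (4, .pair (0, 4) (1, 1)), (1, .pair (0, 4) (4, 1)), (1, .row 2), (1, .row 3),
      (1, .row 4), (3, .point (4, 1))])
    (.split (2, 4)
     (.split (3, 4)
      (.leaf 1 [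
        (3, .reflect (4, 1)), (1, .pair (2, 4) (1, 0)), (1, .pair (3, 4) (1, 0)),
        (1, .pair (3, 4) (1, 1)), (1, .sum (1, 0) (1, 4)), (1, .row 2), (1, .row 3),
        (2, .point (1, 1))])
      (.split (3, 3)
       (.leaf 1 [
         (1, .reflect (4, 1)), (1, .pair (3, 3) (1, 1)), (1, .pair (2, 4) (4, 0)),
         (2, .pair (2, 4) (4, 1)), (1, .row 2), (1, .row 3), (2, .point (1, 1))])
       (.split (4, 3)
        (.split (0, 3)
         (.leaf 3 [
           (1, .reflect (4, 1)), (3, .shift (4, 3)), (1, .pair (1, 1) (1, 1)),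
           (1, .pair (0, 3) (1, 3)), (1, .pair (4, 3) (0, 2)), (3, .pair (4, 3) (2, 3)),
           (5, .pair (2, 4) (4, 1)), (1, .sum (4, 0) (1, 3)), (1, .sum (1, 1) (3, 2)),
           (1, .dir (0, 3) (1, 0)), (1, .dir (0, 3) (4, 0)), (2, .row 2), (2, .row 4)])
         (.split (2, 3)
          (.leaf 5 [
            (3, .reflect (4, 1)), (1, .pair (2, 3) (4, 4)), (2, .pair (4, 3) (0, 2)),
            (1, .pair (4, 3) (4, 4)), (3, .pair (2, 4) (4, 0)), (8, .pair (2, 4) (4, 1)),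
            (1, .pair (2, 4) (4, 2)), (1, .sum (2, 2) (4, 4)), (5, .sum (1, 1) (1, 3)),
            (5, .triple (2, 3) (4, 3)), (4, .row 2), (2, .row 4)])
          (.leaf 10 [
            (5, .reflect (4, 1)), (3, .pair (1, 1) (1, 1)), (4, .pair (4, 1) (1, 1)),
            (5, .pair (2, 4) (4, 0)), (11, .pair (2, 4) (4, 1)), (4, .pair (2, 4) (4, 3)),
            (1, .sum (2, 2) (4, 3)), (4, .sum (1, 1) (3, 2)), (10, .sum (1, 1) (1, 3)),
            (5, .line (0, 1) (4, 0)), (6, .row 2), (5, .row 4)])))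
        (.split (1, 3)
         (.leaf 1 [
           (1, .pair (1, 3) (0, 3)), (3, .pair (2, 4) (4, 1)), (1, .sum (4, 0) (2, 3)),
           (1, .sum (1, 1) (1, 3)), (1, .row 2), (1, .row 4), (1, .point (1, 1))])
         (.leaf 2 [
           (2, .reflect (4, 1)), (2, .pair (4, 1) (0, 3)), (2, .pair (2, 4) (4, 0)),
           (2, .pair (2, 4) (4, 1)), (1, .sum (2, 3) (2, 3)), (2, .row 2),
           (4, .point (1, 1))])))))
     (.split (0, 2)
      (.split (4, 0)
       (.split (3, 2)
        (.split (3, 4)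
         (.leaf 1 [
           (1, .pair (3, 2) (1, 4)), (1, .pair (3, 4) (1, 0)), (2, .sum (1, 1) (4, 1)),
           (1, .triple (1, 1) (3, 4)), (1, .row 2), (1, .row 3)])
         (.split (2, 2)
          (.leaf 4 [
            (2, .shift (2, 2)), (2, .pair (1, 1) (0, 3)), (1, .pair (0, 2) (4, 4)),
            (2, .pair (2, 2) (2, 3)), (1, .pair (2, 2) (4, 4)), (2, .pair (3, 2) (3, 3)),
            (3, .sum (1, 1) (4, 1)), (2, .triple (1, 1) (4, 1)), (2, .dir (0, 2) (1, 0)),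
            (2, .dir (0, 2) (4, 0)), (2, .row 2), (2, .row 3)])
          (.split (3, 3)
           (.leaf 4 [
             (2, .reflect (3, 2)), (2, .pair (4, 1) (0, 3)), (2, .pair (0, 2) (4, 0)),
             (2, .sum (1, 0) (2, 3)), (3, .triple (1, 1) (4, 1)),
             (1, .triple (4, 1) (4, 1)), (4, .dir (0, 2) (1, 0)), (2, .dir (0, 2) (4, 0)),
             (1, .row 2), (2, .row 3)])
           (.leaf 8 [
             (2, .pair (4, 1) (3, 2)), (4, .pair (4, 1) (0, 3)), (4, .pair (0, 2) (1, 4)),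
             (1, .sum (2, 3) (2, 3)), (4, .sum (1, 1) (4, 1)), (4, .triple (1, 1) (4, 1)),
             (2, .triple (4, 1) (4, 1)), (4, .dir (0, 2) (1, 0)), (4, .dir (0, 2) (4, 0)),
             (4, .row 2), (4, .row 3), (4, .point (1, 0)), (4, .point (4, 0))]))))
        (.split (2, 3)
         (.leaf 1 [
           (1, .pair (0, 2) (1, 0)), (1, .pair (2, 3) (2, 2)), (1, .pair (2, 3) (4, 2)),
           (2, .sum (1, 1) (4, 1)), (1, .triple (1, 1) (4, 1)), (1, .row 3), (1, .row 4)])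
         (.split (1, 2)
          (.leaf 3 [
            (1, .pair (1, 1) (3, 4)), (1, .pair (1, 2) (1, 0)), (1, .pair (1, 2) (0, 3)),
            (1, .pair (1, 2) (3, 3)), (7, .sum (1, 1) (4, 1)), (1, .triple (1, 1) (4, 1)),
            (1, .dir (0, 2) (1, 0)), (1, .dir (0, 2) (4, 0)), (2, .row 2), (2, .row 3),
            (2, .row 4)])
          (.split (4, 4)
           (.leaf 2 [
             (2, .pair (0, 2) (4, 0)), (4, .sum (1, 1) (4, 1)), (1, .sum (2, 2) (2, 2)),
             (2, .triple (1, 1) (4, 1)), (2, .row 3), (2, .row 4), (2, .point (1, 0))])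
           (.leaf 9 [
             (4, .pair (1, 1) (2, 2)), (4, .pair (1, 1) (3, 4)), (5, .pair (0, 2) (4, 0)),
             (4, .pair (0, 2) (4, 1)), (4, .pair (0, 2) (1, 4)), (3, .sum (1, 0) (4, 2)),
             (8, .triple (1, 1) (4, 1)), (4, .dir (0, 2) (1, 0)), (4, .line (3, 1) (1, 0)),
             (1, .row 2), (5, .row 3), (1, .row 4)])))))
       (.leaf 1 [
         (4, .sum (1, 1) (4, 1)), (1, .row 2), (1, .row 3), (1, .row 4), (1, .point (1, 0))]))
      (.split (3, 2)
       (.split (2, 2)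
        (.leaf 2 [
          (2, .shift (2, 2)), (2, .pair (2, 2) (4, 0)), (2, .pair (3, 2) (1, 0)),
          (3, .sum (1, 1) (1, 1)), (3, .sum (4, 1) (4, 1)), (2, .row 3), (2, .row 4)])
        (.split (3, 4)
         (.leaf 1 [
           (1, .pair (3, 2) (1, 0)), (1, .pair (3, 2) (1, 4)), (1, .pair (3, 4) (1, 0)),
           (1, .pair (3, 4) (1, 1)), (1, .pair (3, 4) (1, 2)), (1, .triple (3, 2) (3, 4)),
           (1, .row 3)])
         (.split (3, 3)
          (.leaf 3 [
            (1, .reflect (3, 2)), (1, .pair (1, 1) (0, 3)), (2, .pair (3, 2) (1, 0)),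
            (1, .pair (3, 2) (1, 1)), (1, .pair (3, 2) (1, 4)), (3, .pair (3, 3) (1, 1)),
            (2, .pair (3, 3) (1, 2)), (1, .sum (4, 0) (4, 2)), (1, .sum (1, 0) (2, 3)),
            (2, .triple (4, 1) (4, 1)), (1, .line (0, 1) (1, 0)), (2, .row 3)])
          (.split (0, 3)
           (.leaf 8 [
             (4, .pair (4, 1) (3, 2)), (2, .pair (4, 1) (0, 3)), (2, .sum (1, 1) (4, 2)),
             (3, .triple (4, 1) (4, 1)), (8, .dir (0, 3) (1, 0)), (6, .dir (0, 3) (4, 0)),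
             (2, .line (2, 1) (4, 0)), (4, .row 3)])
           (.split (4, 2)
            (.leaf 1 [
              (1, .shift (3, 2)), (1, .pair (3, 2) (1, 1)), (1, .pair (3, 2) (1, 2)),
              (1, .pair (3, 2) (1, 3)), (1, .pair (3, 2) (1, 4)), (1, .pair (4, 2) (2, 3))])
            (.leaf 8 [
              (2, .pair (4, 1) (3, 2)), (8, .pair (3, 2) (1, 1)), (4, .pair (3, 2) (1, 2)),
              (4, .pair (3, 2) (1, 3)), (3, .sum (2, 3) (2, 3)), (6, .triple (4, 1) (4, 1)),
              (4, .line (0, 1) (1, 0)), (4, .row 4), (4, .point (1, 0)), (4, .point (4, 0))]))))))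
       (.split (2, 3)
        (.split (3, 4)
         (.split (4, 4)
          (.leaf 1 [
            (1, .shift (3, 4)), (1, .pair (1, 1) (1, 1)), (1, .pair (2, 3) (4, 1)),
            (1, .pair (2, 3) (4, 2)), (1, .pair (3, 4) (1, 1)), (1, .pair (3, 4) (1, 2)),
            (1, .row 3)])
          (.leaf 2 [
            (1, .pair (1, 1) (1, 1)), (2, .pair (2, 3) (1, 1)), (2, .pair (2, 3) (4, 1)),
            (1, .pair (2, 3) (2, 2)), (2, .pair (2, 3) (4, 2)), (1, .pair (3, 4) (1, 1)),
            (2, .pair (3, 4) (1, 2)), (2, .row 3)]))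
         (.split (2, 2)
          (.leaf 2 [
            (1, .pair (2, 2) (4, 0)), (2, .pair (2, 2) (4, 4)), (2, .pair (2, 3) (4, 1)),
            (1, .pair (2, 3) (2, 2)), (2, .pair (2, 3) (4, 2)), (1, .sum (1, 0) (1, 2)),
            (1, .triple (1, 1) (1, 1)), (2, .row 3), (2, .point (4, 1))])
          (.split (0, 3)
           (.leaf 3 [
             (2, .pair (1, 1) (4, 2)), (2, .pair (2, 3) (1, 0)), (1, .triple (2, 3) (2, 3)),
             (3, .dir (0, 3) (1, 0)), (3, .dir (0, 3) (4, 0)), (1, .row 3),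
             (1, .point (1, 1))])
           (.split (1, 4)
            (.leaf 4 [
              (2, .pair (1, 1) (3, 3)), (1, .pair (2, 3) (4, 0)), (2, .pair (2, 3) (4, 2)),
              (1, .pair (2, 3) (4, 3)), (1, .sum (1, 0) (1, 3)), (1, .sum (4, 0) (3, 3)),
              (3, .sum (1, 1) (1, 2)), (3, .triple (4, 1) (2, 3)), (1, .line (0, 1) (1, 0)),
              (2, .line (0, 1) (4, 0)), (1, .row 3)])
            (.leaf 2 [
              (2, .pair (2, 3) (1, 0)), (2, .sum (1, 0) (1, 3)), (2, .sum (1, 1) (1, 2)),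
              (1, .triple (2, 3) (2, 3)), (2, .line (0, 1) (4, 0))])))))
        (.split (0, 3)
         (.split (3, 3)
          (.split (1, 2)
           (.leaf 9 [
             (1, .reflect (1, 2)), (2, .pair (1, 2) (1, 0)), (4, .triple (3, 3) (3, 3)),
             (8, .dir (0, 3) (1, 0)), (9, .dir (0, 3) (4, 0)), (7, .dir (1, 2) (1, 0)),
             (1, .row 3), (2, .row 4)])
           (.leaf 14 [
             (4, .pair (1, 1) (1, 1)), (1, .pair (1, 1) (3, 4)), (1, .pair (0, 3) (1, 1)),
             (2, .pair (0, 3) (4, 2)), (1, .sum (1, 1) (4, 2)), (5, .triple (3, 3) (3, 3)),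
             (10, .dir (0, 3) (1, 0)), (11, .dir (0, 3) (4, 0)), (10, .line (3, 1) (1, 0)),
             (4, .row 3), (3, .row 4)]))
          (.leaf 6 [
            (2, .pair (1, 1) (1, 1)), (1, .pair (1, 1) (3, 4)), (1, .sum (1, 1) (4, 2)),
            (6, .dir (0, 3) (1, 0)), (5, .dir (0, 3) (4, 0)), (4, .line (3, 1) (1, 0)),
            (2, .row 3), (1, .row 4)]))
         (.split (3, 3)
          (.split (2, 2)
           (.split (4, 3)
            (.leaf 1 [
              (1, .reflect (2, 2)), (1, .pair (2, 2) (4, 1)), (1, .pair (4, 3) (4, 0)),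
              (1, .sum (1, 0) (1, 2)), (1, .sum (1, 1) (1, 1)), (1, .sum (4, 1) (4, 2)),
              (1, .row 4)])
            (.leaf 3 [
              (3, .pair (2, 2) (4, 0)), (3, .pair (2, 2) (4, 1)), (3, .sum (4, 1) (4, 2)),
              (2, .triple (1, 1) (1, 1)), (1, .triple (1, 1) (2, 2)),
              (1, .triple (3, 3) (3, 3)), (3, .row 4), (3, .point (1, 0))]))
           (.leaf 2 [
             (1, .pair (1, 1) (3, 4)), (2, .pair (3, 3) (1, 0)), (1, .pair (3, 3) (1, 1)),
             (1, .pair (3, 3) (1, 2)), (1, .pair (3, 3) (1, 3)), (2, .sum (4, 1) (4, 2)),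
             (1, .triple (3, 3) (3, 3)), (1, .line (0, 1) (1, 0)), (1, .row 4)]))
          (.split (2, 2)
           (.leaf 6 [
             (3, .pair (1, 1) (3, 4)), (7, .pair (2, 2) (4, 1)), (3, .pair (2, 2) (4, 2)),
             (3, .pair (2, 2) (4, 3)), (5, .sum (1, 0) (1, 2)), (5, .triple (1, 1) (1, 1)),
             (3, .line (0, 1) (4, 0)), (1, .row 2), (3, .row 4)])
           (.split (4, 4)
            (.leaf 1 [(1, .sum (1, 0) (3, 4)), (1, .line (0, 1) (1, 0)), (1, .line (0, 1) (4, 0))])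
            (.leaf 2 [
              (1, .pair (1, 1) (3, 4)), (1, .pair (4, 1) (4, 3)), (2, .line (0, 1) (1, 0)),
              (1, .line (0, 1) (4, 0)), (1, .point (4, 1)), (1, .point (4, 2))]))))))))))

set_option maxRecDepth 100000 in
theorem singleTree_check :
    singleTree.check 4 [(1, 0), (0, 1)] [0, (2, 0), (1, 1), (2, 1), (3, 1), (4, 1)] := by
  decide +kernel

set_option maxRecDepth 100000 in
theorem doubleTree_check :
    doubleTree.check 4 [(1, 0), (1, 1), (4, 1)] [0, (2, 0), (0, 1), (2, 1), (3, 1)] := by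
  decide +kernel

set_option maxRecDepth 100000 in
theorem tripleTree_check :
    tripleTree.check 4 [(1, 0), (0, 1), (2, 1), (3, 1)] [0, (2, 0), (1, 1), (4, 1)] := by
  decide +kernel

set_option maxRecDepth 100000 in
theorem sparseDoubleTree_check :
    sparseDoubleTree.check 3 [(1, 0), (1, 1), (4, 1)] [0, (2, 0), (0, 1), (2, 1), (3, 1)] := by
  decide +kernel

set_option maxRecDepth 100000 in
theorem sparseTripleTree_check :
    sparseTripleTree.check 3 [(1, 0), (0, 1), (2, 1), (3, 1)] [0, (2, 0), (1, 1), (4, 1)] := by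
  decide +kernel

namespace Profile

variable {x : Plane → ℕ} {q : ℕ}

theorem isExceptional_of_dense (P : Profile x q) (he : 4 * q < x (1, 0)) : IsExceptional x := by
  have hq := P.pos
  obtain ⟨d, hd, hmax⟩ := exists_rowSum_max x
  have hrow : 9 * q ≤ 2 * rowSum x d := by
    have h0 : rowSum x 0 ≤ 10 * q := by
      simpa [rowSum] using P.dir (1, 0) 0 (by decide) (by omega)
    have ht := P.total.trans_eq (sum_eq_rowSum x)
    have h1 := hmax 1 (by decide)
    have h2 := hmax 2 (by decide)
    have h3 := hmax 3 (by decide)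
    have h4 := hmax 4 (by decide)
    omega
  rcases P.row_cases (by norm_num) P.le he hd hmax doubleTree_check tripleTree_check with
    h | ⟨c, hc⟩ | h | h
  · exact h
  · have hc₀ : ∀ k, x (k, d) = 0 ↔ k ≠ c := fun k => by
      rw [ne_eq, ← hc, Nat.pos_iff_ne_zero, not_not]
    refine ((P.normalized P.le he hd hmax c).isExceptional_of_check singleTree _ _ ?_ ?_
      singleTree_check).of_comp
    · simp [triangular_apply, hc, (Nat.zero_le _).trans_lt he]
    · simp +decide [triangular_apply, P.eq_zero_of_lt (by omega), hc₀]
  · omega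
  · have : 2 * rowSum x d ≤ _ := two_mul_sum_le_of_cycle h
    omega

theorem rowSum_zero_le (P : Profile x q) (he : 3 * q < x (1, 0)) (hle : ∀ g, x g ≤ 4 * q) :
    rowSum x 0 ≤ 8 * q ∧ (rowSum x 0 = 8 * q → x (1, 0) = 4 * q) := by
  have := P.pos
  obtain ⟨h0, h2⟩ := P.eq_zero_of_lt he
  have hsum : rowSum x 0 = x (0, 0) + x (1, 0) + x (2, 0) + x (3, 0) + x (4, 0) :=
    Fin.sum_univ_five fun i => x (i, 0)
  rw [hsum, h0, h2]
  have h1 := hle (1, 0)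
  have h3 := hle (3, 0)
  have h4 := hle (4, 0)
  rcases Nat.eq_zero_or_pos (x (3, 0)) with h3' | h3'
  · omega
  rcases Nat.eq_zero_or_pos (x (4, 0)) with h4' | h4'
  · have : x (3, 0) + x (3, 0) ≤ 5 * q := P.pairSum (3, 0) (3, 0) ((Nat.zero_le _).trans_lt he)
    omega
  · have : x (3, 0) + x (4, 0) + 3 * q ≤ 5 * q :=
      P.triple (1, 0) (3, 0) 3 ((Nat.zero_le _).trans_lt he) h3' h4' he
    omega

theorem isExceptional_or_rowSum_le (P : Profile x q) (hle : ∀ g, x g ≤ 4 * q)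
    (he : 3 * q < x (1, 0)) {d : ZMod 5} (hd : d ≠ 0)
    (hmax : ∀ j, j ≠ 0 → rowSum x j ≤ rowSum x d) :
    IsExceptional x ∨ rowSum x d ≤ 5 * q ∧ (rowSum x d = 5 * q → ∀ i, x (i, d) = q) := by
  have hq := P.pos
  rcases P.row_cases le_rfl hle he hd hmax sparseDoubleTree_check sparseTripleTree_check with
    h | ⟨c, hc⟩ | h | h
  · exact .inl h
  · have hsum : rowSum x d = x (c, d) := Fintype.sum_eq_single c fun k hk =>
      Nat.eq_zero_of_not_pos (mt (hc k).1 hk)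
    have := hle (c, d)
    exact .inr (by omega)
  · exact .inr (by omega)
  · have : 2 * rowSum x d ≤ _ := two_mul_sum_le_of_cycle h
    exact .inr ⟨by omega, fun h5 => eq_of_cycle h h5⟩

theorem isExceptional_or_eq (P : Profile x q) (hle : ∀ g, x g ≤ 4 * q) (he : 3 * q < x (1, 0)) :
    IsExceptional x ∨ x (1, 0) = 4 * q ∧ ∀ i j, j ≠ 0 → x (i, j) = q := by
  obtain ⟨hrow, hrow_eq⟩ := P.rowSum_zero_le he hle
  obtain ⟨d, hd, hmax⟩ := exists_rowSum_max x
  rcases P.isExceptional_or_rowSum_le hle he hd hmax with h | ⟨h5, -⟩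
  · exact .inl h
  have hall : rowSum x 0 = 8 * q ∧ ∀ j, j ≠ 0 → rowSum x j = 5 * q := by
    have ht := P.total.trans_eq (sum_eq_rowSum x)
    have h1 := hmax 1 (by decide)
    have h2 := hmax 2 (by decide)
    have h3 := hmax 3 (by decide)
    have h4 := hmax 4 (by decide)
    refine ⟨by omega, fun j hj => ?_⟩
    have hj : j = 1 ∨ j = 2 ∨ j = 3 ∨ j = 4 := by
      revert j
      decide
    rcases hj with rfl | rfl | rfl | rfl <;> omega
  by_contra! hx
  refine (hx.2 (hrow_eq hall.1)).elim fun i ⟨j, hj, hij⟩ => hij ?_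
  have hmax : ∀ k, k ≠ 0 → rowSum x k ≤ rowSum x j := fun k hk => by rw [hall.2 k hk, hall.2 j hj]
  exact ((P.isExceptional_or_rowSum_le hle he hj hmax).resolve_left hx.1).2 (hall.2 j hj) i

end Profile

/-! ### Sumsets and fibres -/

theorem natCard_eq_prime_pow_finrank (p : ℕ) [Fact p.Prime] (V : Type*) [AddCommGroup V]
    [Module (ZMod p) V] [Finite V] : Nat.card V = p ^ Module.finrank (ZMod p) V := by
  rw [Module.natCard_eq_pow_finrank (K := ZMod p), Nat.card_zmod]

section Sumset

open Finset AddAction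
open scoped Pointwise

variable {G : Type*} [AddCommGroup G]

theorem card_le_of_sub_mem {K : AddSubgroup G} [Finite K] {Y : Finset G}
    (hY : ∀ y ∈ Y, ∀ z ∈ Y, y - z ∈ K) : #Y ≤ Nat.card K := by
  rcases Y.eq_empty_or_nonempty with rfl | ⟨z, hz⟩
  · exact Nat.zero_le _
  · rw [← Nat.card_eq_finsetCard]
    exact Nat.card_le_card_of_injective (fun y : Y => (⟨y - z, hY y y.2 z hz⟩ : K))
      fun _ _ h => Subtype.ext (sub_left_injective (congrArg Subtype.val h))

variable [DecidableEq G]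

theorem exists_dyson_stable (X : Finset G) {Y : Finset G} (hY : Y.Nonempty) :
    ∃ X' Y' : Finset G, X ⊆ X' ∧ Y' ⊆ Y ∧ Y'.Nonempty ∧ #X' + #Y' = #X + #Y ∧
      X' + Y' ⊆ X + Y ∧ ∀ y ∈ Y', ∀ z ∈ Y', y - z ∈ stabilizer G X' := by
  induction hn : #Y using Nat.strong_induction_on generalizing X Y with
  | _ n ih =>
  subst hn
  by_cases h : ∀ y ∈ Y, ∀ z ∈ Y, y - z ∈ stabilizer G X
  · exact ⟨X, Y, Subset.rfl, Subset.rfl, hY, rfl, Subset.rfl, h⟩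
  simp only [mem_stabilizer_finset', vadd_eq_add] at h
  push Not at h
  obtain ⟨y, hy, z, hz, x, hx, hxy⟩ := h
  set T := addDysonETransform (x - z) (X, Y)
  have hzT : z ∈ T.2 := mem_inter.2 ⟨hz, mem_vadd_finset.2 ⟨x, hx, by simp⟩⟩
  have hyT : y ∉ T.2 := by
    intro h
    obtain ⟨w, hw, hwy⟩ := mem_vadd_finset.1 (mem_inter.1 h).2
    rw [← hwy, vadd_eq_add] at hxy
    exact hxy (by convert hw using 1; abel)
  have hsub : T.2 ⊆ Y := inter_subset_left
  obtain ⟨X', Y', hX', hY', hne, hcard, hadd, hstab⟩ :=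
    ih _ (card_lt_card ((ssubset_iff_of_subset hsub).2 ⟨y, hy, hyT⟩)) T.1 ⟨z, hzT⟩ rfl
  exact ⟨X', Y', subset_union_left.trans hX', hY'.trans hsub, hne,
    hcard.trans (addDysonETransform.card _ _), hadd.trans (addDysonETransform.subset _ _), hstab⟩

theorem card_dvd_card_of_le_stabilizer {X : Finset G} {K : AddSubgroup G}
    (hK : K ≤ stabilizer G X) : Nat.card K ∣ #X := by
  set π : G → G ⧸ K := QuotientAddGroup.mk
  have hX : π ⁻¹' (π '' X) = X := by
    refine Set.Subset.antisymm ?_ (Set.subset_preimage_image _ _)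
    rintro y ⟨x, hx, hxy⟩
    have := mem_stabilizer_finset'.1 (hK (QuotientAddGroup.eq.1 hxy)) hx
    rwa [vadd_eq_add, neg_add_eq_sub, sub_add_cancel] at this
  have := Nat.card_congr (QuotientAddGroup.preimageMkEquivAddSubgroupProdSet K (π '' X))
  rw [Nat.card_prod, hX] at this
  exact ⟨_, by simpa using this⟩

/-- A form of Kneser's theorem: it suffices to translate the first of the two sets provided by
`exists_dyson_stable` by an element of the second. -/
theorem exists_stable_subset_add {X Y : Finset G} (hX : X.Nonempty) (hY : Y.Nonempty)
    {W : AddSubgroup G} (hW : ∀ y ∈ Y, ∀ z ∈ Y, y - z ∈ W) :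
    ∃ K ≤ W, ∃ S ⊆ X + Y, K ≤ stabilizer G S ∧ (∃ y ∈ Y, ∀ x ∈ X, x + y ∈ S) ∧
      #X + #Y ≤ #S + Nat.card K := by
  obtain ⟨X', Y', hX', hY', ⟨z, hz⟩, hcard, hadd, hstab⟩ := exists_dyson_stable X hY
  set K := stabilizer G X' ⊓ W
  have hpos : 0 < #X' := (hX.mono hX').card_pos
  have : Finite K := Nat.finite_of_card_ne_zero fun h =>
    hpos.ne' (Nat.eq_zero_of_zero_dvd (h ▸ card_dvd_card_of_le_stabilizer inf_le_left))
  refine ⟨K, inf_le_right, z +ᵥ X', ?_, ?_, ⟨z, hY' hz, fun x hx => ?_⟩, ?_⟩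
  · rw [vadd_finset_def]
    exact image_subset_iff.2 fun x hx => hadd (by simpa [add_comm] using add_mem_add hx hz)
  · intro k hk
    rw [mem_stabilizer_iff, vadd_comm, mem_stabilizer_iff.1 hk.1]
  · exact mem_vadd_finset.2 ⟨x, hX' hx, add_comm z x⟩
  · rw [card_vadd_finset, ← hcard]
    exact Nat.add_le_add_left (card_le_of_sub_mem fun y hy y' hy' => AddSubgroup.mem_inf.2
      ⟨hstab y hy y' hy', hW y (hY' hy) y' (hY' hy')⟩) _

theorem mul_pow_le_card_add {p d t : ℕ} [Fact p.Prime] {W : AddSubgroup G}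
    (hcardW : Nat.card W = p ^ (d + 1)) (ht : t ≤ p) {X Y : Finset G} (hX : X.Nonempty)
    (hY : Y.Nonempty) (hW : ∀ y ∈ Y, ∀ z ∈ Y, y - z ∈ W) (hXY : t * p ^ d < #X + #Y) :
    t * p ^ d ≤ #(X + Y) := by
  obtain ⟨K, hKW, S, hS, hK, ⟨y, -, hy⟩, hlt⟩ := exists_stable_subset_add hX hY hW
  obtain ⟨x, hx⟩ := hX
  obtain ⟨c, hc⟩ := card_dvd_card_of_le_stabilizer hK
  have hpos : 0 < c := Nat.pos_of_mul_pos_left (hc ▸ card_pos.2 ⟨_, hy x hx⟩)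
  obtain ⟨k, hk, hcardK⟩ := (Nat.dvd_prime_pow Fact.out).1
    (hcardW ▸ AddSubgroup.card_dvd_of_le hKW)
  rw [hcardK] at hc hlt
  refine le_trans ?_ (card_le_card hS)
  rw [hc, mul_comm _ c] at hlt ⊢
  rcases hk.lt_or_eq with hk | rfl
  · have hd : p ^ d = p ^ (d - k) * p ^ k := by rw [← pow_add, Nat.sub_add_cancel (by omega)]
    rw [hd, ← mul_assoc] at hXY ⊢
    rw [← Nat.succ_mul] at hlt
    have := lt_of_mul_lt_mul_right (hXY.trans_le hlt) (Nat.zero_le _)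
    exact Nat.mul_le_mul_right _ (Nat.lt_succ_iff.1 this)
  · calc t * p ^ d ≤ p * p ^ d := Nat.mul_le_mul_right _ ht
      _ = 1 * p ^ (d + 1) := by ring
      _ ≤ c * p ^ (d + 1) := Nat.mul_le_mul_right _ hpos

theorem exists_submodule_stable {p e : ℕ} [Fact p.Prime] [Module (ZMod p) G] [Finite G]
    {X Y : Finset G} (hX : X.Nonempty) (hY : Y.Nonempty) {W : Submodule (ZMod p) G}
    (hW : ∀ y ∈ Y, ∀ z ∈ Y, y - z ∈ W) (hlt : #(X + Y) < p ^ (e + 1))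
    (hle : p ^ e + p * #(X + Y) < p * (#X + #Y)) :
    ∃ K ≤ W, Module.finrank (ZMod p) K = e ∧ ∃ S ⊆ X + Y, (∀ k ∈ K, ∀ s ∈ S, k + s ∈ S) ∧
      (∃ y ∈ Y, ∀ x ∈ X, x + y ∈ S) ∧ #X + #Y ≤ #S + p ^ e := by
  obtain ⟨K, hKW, S, hS, hK, ⟨y, hy, hyS⟩, hcard⟩ :=
    exists_stable_subset_add hX hY (W := W.toAddSubgroup) hW
  have hp : 1 < p := (Fact.out : p.Prime).one_lt
  let V := AddSubgroup.toZModSubmodule p K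
  have hV : Nat.card K = p ^ Module.finrank (ZMod p) V :=
    natCard_eq_prime_pow_finrank p V
  obtain ⟨x, hx⟩ := hX
  have hKS : Nat.card K ≤ #S :=
    Nat.le_of_dvd (card_pos.2 ⟨_, hyS x hx⟩) (card_dvd_card_of_le_stabilizer hK)
  have hSXY := card_le_card hS
  have hfin : Module.finrank (ZMod p) V = e := by
    apply le_antisymm
    · rw [← Nat.lt_succ_iff, ← Nat.pow_lt_pow_iff_right hp, ← hV]
      exact (hKS.trans hSXY).trans_lt hlt
    · rw [← Nat.lt_succ_iff, ← Nat.pow_lt_pow_iff_right hp, pow_succ, ← hV]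
      nlinarith
  exact ⟨V, hKW, hfin, S, hS, fun k hk s hs => mem_stabilizer_finset'.1 (hK hk) hs,
    ⟨y, hy, hyS⟩, by rwa [hV, hfin] at hcard⟩

end Sumset

section Fibre

open Finset
open scoped Pointwise

open Classical in
/-- The part of `A` on which `φ` takes the value `g`. -/
noncomputable def fibre {G M : Type*} (A : Finset G) (φ : G → M) (g : M) : Finset G :=
  {a ∈ A | φ a = g}

theorem mem_fibre {G M : Type*} {A : Finset G} {φ : G → M} {g : M} {a : G} :
    a ∈ fibre A φ g ↔ a ∈ A ∧ φ a = g := by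
  simp only [fibre, mem_filter]

theorem sum_card_fibre {G M : Type*} [Fintype M] (A : Finset G) (φ : G → M) :
    ∑ g, #(fibre A φ g) = #A := by
  classical
  exact (card_eq_sum_card_fiberwise fun _ _ => mem_univ _).symm

theorem sum_card_fibre_prod {G M N : Type*} [Fintype M] (A : Finset G) (φ : G → M × N) (n : N) :
    ∑ m, #(fibre A φ (m, n)) = #(fibre A (Prod.snd ∘ φ) n) := by
  rw [← sum_card_fibre (fibre A (Prod.snd ∘ φ) n) (Prod.fst ∘ φ)]
  refine sum_congr rfl fun m _ => congrArg card (Finset.ext fun a => ?_)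
  simp only [mem_fibre, Function.comp_apply, Prod.ext_iff]
  tauto

variable {R G M : Type*} [Ring R] [AddCommGroup G] [Module R G] [AddCommGroup M] [Module R M]
  (φ : G →ₗ[R] M)

theorem sub_mem_ker_of_mem_fibre {φ : G →ₗ[R] M} {A : Finset G} {g : M} :
    ∀ a ∈ fibre A φ g, ∀ b ∈ fibre A φ g, a - b ∈ LinearMap.ker φ := fun a ha b hb => by
  rw [LinearMap.sub_mem_ker_iff, (mem_fibre.1 ha).2, (mem_fibre.1 hb).2]

theorem card_le_card_ker [Finite G] {φ : G →ₗ[R] M} {S : Finset G} {g : M}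
    (hS : ∀ s ∈ S, φ s = g) : #S ≤ Nat.card (LinearMap.ker φ) :=
  card_le_of_sub_mem (K := (LinearMap.ker φ).toAddSubgroup) fun y hy z hz =>
    LinearMap.sub_mem_ker_iff.2 ((hS y hy).trans (hS z hz).symm)

theorem card_fibre_le [Finite G] (A : Finset G) (g : M) :
    #(fibre A φ g) ≤ Nat.card (LinearMap.ker φ) :=
  card_le_card_ker fun _ hs => (mem_fibre.1 hs).2

theorem card_fibre_univ [Fintype G] {φ : G →ₗ[R] M} (hφ : Function.Surjective φ) (g : M) :
    #(fibre univ φ g) = Nat.card (LinearMap.ker φ) := by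
  obtain ⟨x, rfl⟩ := hφ g
  refine le_antisymm (card_fibre_le φ _ _) ?_
  rw [← Nat.card_eq_finsetCard]
  exact Nat.card_le_card_of_injective
    (fun k : LinearMap.ker φ =>
      (⟨x + k, mem_fibre.2 ⟨mem_univ _, by rw [map_add, LinearMap.map_coe_ker, add_zero]⟩⟩ :
        fibre univ φ (φ x)))
    fun _ _ h => Subtype.ext (add_left_cancel (congrArg Subtype.val h))

theorem card_fibre_add_card_fibre_compl [Fintype G] [DecidableEq G] (A : Finset G) {φ : G →ₗ[R] M}
    (hφ : Function.Surjective φ) (g : M) :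
    #(fibre A φ g) + #(fibre Aᶜ φ g) = Nat.card (LinearMap.ker φ) := by
  rw [← card_fibre_univ hφ g, ← card_union_of_disjoint]
  · simp only [fibre, ← filter_union, union_compl]
  · classical exact disjoint_filter_filter disjoint_compl_right

theorem card_filter_mem [Fintype G] {φ : G →ₗ[R] M} (hφ : Function.Surjective φ) (T : Finset M)
    [DecidablePred (φ · ∈ T)] :
    #{z | φ z ∈ T} = #T * Nat.card (LinearMap.ker φ) := by
  classical
  rw [card_eq_sum_card_fiberwise (f := φ) (t := T) fun z hz => by simpa using hz, ← smul_eq_mul]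
  refine sum_eq_card_nsmul fun g hg => ?_
  rw [← card_fibre_univ hφ g, fibre, filter_filter]
  exact congrArg card (filter_congr fun z _ => and_iff_right_of_imp fun h => h ▸ hg)

section SumFree

variable [Finite G] {A : Finset G} (hA : IsSumFree (A : Set G))
include hA

theorem IsSumFree.card_fibre_add [DecidableEq G] (g h : M) :
    #(fibre A φ g + fibre A φ h) + #(fibre A φ (g + h)) ≤ Nat.card (LinearMap.ker φ) := by
  rw [← card_union_of_disjoint]
  · refine card_le_card_ker (g := g + h) fun s hs => ?_
    rcases mem_union.1 hs with hs | hs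
    · obtain ⟨a, ha, b, hb, rfl⟩ := mem_add.1 hs
      rw [map_add, (mem_fibre.1 ha).2, (mem_fibre.1 hb).2]
    · exact (mem_fibre.1 hs).2
  · refine disjoint_left.2 fun s hs hs' => ?_
    obtain ⟨a, ha, b, hb, rfl⟩ := mem_add.1 hs
    exact hA a (mem_fibre.1 ha).1 b (mem_fibre.1 hb).1 (mem_fibre.1 hs').1

theorem IsSumFree.card_fibre_sub [DecidableEq G] (g h : M) :
    #(fibre A φ (g + h) - fibre A φ h) + #(fibre A φ g) ≤ Nat.card (LinearMap.ker φ) := by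
  rw [← card_union_of_disjoint]
  · refine card_le_card_ker (g := g) fun s hs => ?_
    rcases mem_union.1 hs with hs | hs
    · obtain ⟨a, ha, b, hb, rfl⟩ := mem_sub.1 hs
      rw [map_sub, (mem_fibre.1 ha).2, (mem_fibre.1 hb).2, add_sub_cancel_right]
    · exact (mem_fibre.1 hs).2
  · refine disjoint_left.2 fun s hs hs' => ?_
    obtain ⟨a, ha, b, hb, rfl⟩ := mem_sub.1 hs
    exact hA _ (mem_fibre.1 hs').1 b (mem_fibre.1 hb).1
      (by simpa using (mem_fibre.1 ha).1)

theorem IsSumFree.card_fibre_pair {g : M} (hg : (fibre A φ g).Nonempty) (h : M) :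
    #(fibre A φ h) + #(fibre A φ (g + h)) ≤ Nat.card (LinearMap.ker φ) := by
  classical
  exact (Nat.add_le_add_right (card_le_card_add_left hg) _).trans (hA.card_fibre_add φ g h)

theorem IsSumFree.card_fibre_pairSum {g h : M} (hgh : (fibre A φ (g + h)).Nonempty) :
    #(fibre A φ g) + #(fibre A φ h) ≤ Nat.card (LinearMap.ker φ) := by
  classical
  rw [add_comm]
  exact (Nat.add_le_add_right (card_le_card_sub_left hgh) _).trans (hA.card_fibre_sub φ g h)

variable {p d : ℕ} [Fact p.Prime] (hd : Nat.card (LinearMap.ker φ) = p ^ (d + 1)) {g h : M} {m : ℕ}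
include hd

theorem IsSumFree.card_fibre_tripleSum (hg : (fibre A φ g).Nonempty) (hh : (fibre A φ h).Nonempty)
    (hm : m * p ^ d < #(fibre A φ (g + h))) :
    #(fibre A φ g) + #(fibre A φ h) + m * p ^ d ≤ p ^ (d + 1) := by
  classical
  have hadd := hA.card_fibre_add φ g h
  by_contra! hlt
  have hle : (p - m) * p ^ d ≤ #(fibre A φ g + fibre A φ h) :=
    mul_pow_le_card_add (W := (LinearMap.ker φ).toAddSubgroup) hd (Nat.sub_le p m) hg hh
      sub_mem_ker_of_mem_fibre (by rw [Nat.sub_mul, ← pow_succ']; omega)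
  rw [Nat.sub_mul, ← pow_succ'] at hle
  omega

theorem IsSumFree.card_fibre_triple (hh : (fibre A φ h).Nonempty)
    (hgh : (fibre A φ (g + h)).Nonempty) (hm : m * p ^ d < #(fibre A φ g)) :
    #(fibre A φ h) + #(fibre A φ (g + h)) + m * p ^ d ≤ p ^ (d + 1) := by
  classical
  have hsub := hA.card_fibre_sub φ g h
  by_contra! hlt
  have hle : (p - m) * p ^ d ≤ #(-fibre A φ h + fibre A φ (g + h)) :=
    mul_pow_le_card_add (W := (LinearMap.ker φ).toAddSubgroup) hd (Nat.sub_le p m) hh.neg hgh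
      sub_mem_ker_of_mem_fibre (by rw [card_neg, Nat.sub_mul, ← pow_succ']; omega)
  rw [Nat.sub_mul, ← pow_succ', neg_add_eq_sub] at hle
  omega

end SumFree

theorem card_le_half_of_forall_add_one_notMem {n : ℕ} [NeZero n] {s : Finset (ZMod n)}
    (hs : ∀ k ∈ s, k + 1 ∉ s) : #s ≤ n / 2 := by
  have hdisj : Disjoint s (s.map (addRightEmbedding 1)) := disjoint_right.2 fun k hk => by
    obtain ⟨l, hl, rfl⟩ := mem_map.1 hk
    exact hs l hl
  have := card_le_univ (s ∪ s.map (addRightEmbedding 1))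
  rw [card_union_of_disjoint hdisj, card_map, ZMod.card] at this
  omega

/-- On every line in the direction of an element `a` of a sum-free set, no two points of the set
are at distance `a`. -/
theorem IsSumFree.mul_card_fibre_le {n : ℕ} [NeZero n] [Finite G] [Module (ZMod n) G]
    [Module (ZMod n) M] (φ : G →ₗ[ZMod n] M) {A : Finset G} (hA : IsSumFree (A : Set G)) {a : G}
    (ha : a ∈ A) (hφ : φ a = 0) (c : M) :
    n * #(fibre A φ c) ≤ n / 2 * Nat.card (LinearMap.ker φ) := by
  classical
  let f : G × ZMod n → G := fun z => z.1 - z.2 • a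
  have hf : ∀ w ∈ (fibre A φ c ×ˢ univ).image f, φ w = c := by
    simp only [mem_image, mem_product, mem_fibre, Prod.exists, f]
    rintro _ ⟨z, k, hz, rfl⟩
    simp [hz.1.2, hφ]
  have hline : ∀ w, #{z ∈ fibre A φ c ×ˢ (univ : Finset (ZMod n)) | f z = w} ≤ n / 2 := fun w => by
    rw [← card_image_of_injOn (f := Prod.snd)]
    · refine card_le_half_of_forall_add_one_notMem fun k hk hk' => ?_
      simp only [mem_image, mem_filter, mem_product, mem_fibre, Prod.exists, f, sub_eq_iff_eq_add]
        at hk hk'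
      obtain ⟨y, _, ⟨⟨hy, -⟩, rfl⟩, rfl⟩ := hk
      obtain ⟨z, _, ⟨⟨hz, -⟩, rfl⟩, rfl⟩ := hk'
      exact hA _ hy.1 a ha (by simpa [add_smul, add_assoc] using hz.1)
    · rintro ⟨y, k⟩ hy ⟨z, l⟩ hz (rfl : k = l)
      simp_all [f, sub_eq_iff_eq_add]
  calc n * #(fibre A φ c) = #(fibre A φ c ×ˢ (univ : Finset (ZMod n))) := by
        rw [card_product, card_univ, ZMod.card, mul_comm]
    _ ≤ n / 2 * #((fibre A φ c ×ˢ univ).image f) := card_le_mul_card_image _ _ fun w _ => hline w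
    _ ≤ n / 2 * Nat.card (LinearMap.ker φ) := Nat.mul_le_mul_left _ (card_le_card_ker hf)

end Fibre

section LinearAlgebra

open Module

variable {K V W : Type*} [Field K] [AddCommGroup V] [Module K V] [AddCommGroup W] [Module K W]

theorem exists_linearEquiv_apply_eq {v w : V} (hv : v ≠ 0) (hw : w ≠ 0) :
    ∃ e : V ≃ₗ[K] V, e v = w := by
  obtain ⟨e, he⟩ := Submodule.exists_linearEquiv_restrict_eq
    ((LinearEquiv.toSpanNonzeroSingleton K V v hv).symm.trans
      (LinearEquiv.toSpanNonzeroSingleton K V w hw))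
  have h := he (LinearEquiv.toSpanNonzeroSingleton K V v hv 1)
  rw [LinearEquiv.trans_apply, LinearEquiv.symm_apply_apply] at h
  exact ⟨e, by simpa using h.symm⟩

variable [FiniteDimensional K V]

theorem finrank_eq_of_surjective {φ : V →ₗ[K] W} (h : Function.Surjective φ) :
    finrank K V = finrank K W + finrank K (LinearMap.ker φ) := by
  rw [← φ.finrank_range_add_finrank_ker, LinearMap.range_eq_top.2 h, finrank_top]

theorem ker_prod_eq_of_finrank {φ : V →ₗ[K] W} {U : Submodule K V} (hU : U ≤ LinearMap.ker φ)
    (hfin : finrank K (LinearMap.ker φ) = finrank K U + 1) {f : V →ₗ[K] K}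
    (hf : U ≤ LinearMap.ker f) {v : V} (hvφ : φ v = 0) (hfv : f v ≠ 0) :
    LinearMap.ker (φ.prod f) = U := by
  have hlt : LinearMap.ker (φ.prod f) < LinearMap.ker φ := by
    rw [LinearMap.ker_prod]
    exact inf_le_left.lt_of_ne fun h => hfv (inf_eq_left.1 h hvφ)
  have := Submodule.finrank_lt_finrank_of_lt hlt
  refine (Submodule.eq_of_le_of_finrank_le ?_ (by omega)).symm
  rw [LinearMap.ker_prod]
  exact le_inf hU hf

theorem exists_ker_prod_eq {φ : V →ₗ[K] W} {U : Submodule K V} (hU : U ≤ LinearMap.ker φ)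
    (hfin : finrank K (LinearMap.ker φ) = finrank K U + 1) :
    ∃ f : V →ₗ[K] K, LinearMap.ker (φ.prod f) = U := by
  obtain ⟨v, hvφ, hvU⟩ : ∃ v ∈ LinearMap.ker φ, v ∉ U :=
    SetLike.exists_of_lt (hU.lt_of_ne fun h => by rw [h] at hfin; omega)
  obtain ⟨f, hfv, hUf⟩ := Submodule.exists_le_ker_of_notMem hvU
  exact ⟨f, ker_prod_eq_of_finrank hU hfin hUf hvφ hfv⟩

theorem exists_ker_prod_eq_apply_eq {φ : V →ₗ[K] W} {U : Submodule K V}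
    (hU : U ≤ LinearMap.ker φ) (hfin : finrank K (LinearMap.ker φ) = finrank K U + 1) {v w : V}
    (hφ : φ v = φ w) (hw : φ w ≠ 0) (hvw : v - w ∉ U) :
    ∃ f : V →ₗ[K] K, LinearMap.ker (φ.prod f) = U ∧ f w = 0 ∧ f v = 1 := by
  have hφvw : φ (v - w) = 0 := by rw [map_sub, hφ, sub_self]
  have hnot : v - w ∉ U ⊔ Submodule.span K {w} := fun h => by
    obtain ⟨k, hk, _, hs, hks⟩ := Submodule.mem_sup.1 h
    obtain ⟨c, rfl⟩ := Submodule.mem_span_singleton.1 hs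
    have hc : c • φ w = 0 := by
      rw [← map_smul, ← hφvw, ← hks, map_add, LinearMap.mem_ker.1 (hU hk), zero_add]
    rw [(smul_eq_zero.1 hc).resolve_right hw, zero_smul, add_zero] at hks
    exact hvw (hks ▸ hk)
  obtain ⟨f, hf, hUf⟩ := Submodule.exists_le_ker_of_notMem hnot
  have hfw : f w = 0 := hUf (Submodule.mem_sup_right (Submodule.mem_span_singleton_self w))
  rw [map_sub, hfw, sub_zero] at hf
  have hv : ((f v)⁻¹ • f) v = 1 := inv_mul_cancel₀ hf
  have hw : ((f v)⁻¹ • f) w = 0 := by rw [LinearMap.smul_apply, hfw, smul_zero]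
  refine ⟨(f v)⁻¹ • f, ker_prod_eq_of_finrank hU hfin (fun u hu => ?_) hφvw ?_, hw, hv⟩
  · have hfu : f u = 0 := hUf (Submodule.mem_sup_left hu)
    rw [LinearMap.mem_ker, LinearMap.smul_apply, hfu, smul_zero]
  · rw [map_sub, hv, hw, sub_zero]
    exact one_ne_zero

variable [FiniteDimensional K W]

theorem surjective_of_finrank_eq {φ : V →ₗ[K] W}
    (h : finrank K V = finrank K W + finrank K (LinearMap.ker φ)) : Function.Surjective φ := by
  have := φ.finrank_range_add_finrank_ker
  exact LinearMap.range_eq_top.1 (Submodule.eq_top_of_finrank_eq (by omega))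

theorem exists_ker_eq_apply_eq {U : Submodule K V} (hU : finrank K V = finrank K W + finrank K U)
    {t : V} (ht : t ∉ U) {w : W} (hw : w ≠ 0) :
    ∃ φ : V →ₗ[K] W, Function.Surjective φ ∧ LinearMap.ker φ = U ∧ φ t = w := by
  have hquot : finrank K (V ⧸ U) = finrank K W := by
    have := U.finrank_quotient_add_finrank
    omega
  let e := LinearEquiv.ofFinrankEq (V ⧸ U) W hquot
  obtain ⟨ψ, hψ⟩ := exists_linearEquiv_apply_eq (K := K) (v := e (U.mkQ t)) (w := w) (by simpa) hw
  refine ⟨(e.trans ψ).toLinearMap ∘ₗ U.mkQ, ?_, ?_, hψ⟩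
  · exact (e.trans ψ).surjective.comp U.mkQ_surjective
  · rw [LinearEquiv.ker_comp, U.ker_mkQ]

theorem exists_linearEquiv_prod {U : Type*} [AddCommGroup U] [Module K U] [FiniteDimensional K U]
    {φ : V →ₗ[K] W} (hφ : Function.Surjective φ) (hU : finrank K V = finrank K W + finrank K U) :
    ∃ e : V ≃ₗ[K] W × U, ∀ v, (e v).1 = φ v := by
  have hfin := finrank_eq_of_surjective hφ
  let ε : LinearMap.ker φ ≃ₗ[K] U := LinearEquiv.ofFinrankEq _ U (by omega)
  obtain ⟨ρ, hρ⟩ := LinearMap.exists_extend (p := LinearMap.ker φ) ε.toLinearMap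
  have hinj : Function.Injective (φ.prod ρ) := by
    refine (injective_iff_map_eq_zero _).2 fun v hv => ?_
    have hvφ : φ v = 0 := congrArg Prod.fst hv
    have hvε : ε ⟨v, hvφ⟩ = 0 := (LinearMap.congr_fun hρ ⟨v, hvφ⟩).symm.trans (congrArg Prod.snd hv)
    exact congrArg Subtype.val (ε.map_eq_zero_iff.1 hvε)
  exact ⟨LinearMap.linearEquivOfInjective _ hinj (by rw [hU, finrank_prod]), fun _ => rfl⟩

end LinearAlgebra

/-! ### Fibres of large sum-free sets -/

section Level

open Finset
open scoped Pointwise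

theorem card_le_one_of_card_add_le {p : ℕ} [Fact p.Prime] {B C : Finset (ZMod p)}
    (hB : B.Nonempty) (hB' : B ≠ univ) (h : #(B + C) ≤ #B) : #C ≤ 1 := by
  rcases C.eq_empty_or_nonempty with rfl | hC
  · exact Nat.zero_le _
  · have hlt : #B < p := by simpa using card_lt_univ_of_notMem (not_forall.1
      (mt eq_univ_iff_forall.2 hB')).choose_spec
    have := ZMod.cauchy_davenport Fact.out hB hC
    have := hB.card_pos
    omega

namespace SumFreeProfile

variable {x : Plane → ℕ} {q : ℕ} (P : SumFreeProfile x q)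
include P

theorem rowSum_add_rowSum_le {c : ZMod 5} (hc : 0 < x (c, 3)) (b : ZMod 5) :
    rowSum x 1 + rowSum x 4 ≤ x (b, 1) + x (b + c, 4) + 20 * q := by
  have hshift : rowSum x 4 = ∑ b, x (b + c, 4) :=
    (Equiv.sum_comp (Equiv.addRight c) fun z => x (z, 4)).symm
  have hpair : ∀ b, x (b, 1) + x (b + c, 4) ≤ 5 * q := fun b => by
    simpa [add_comm c, show (3 : ZMod 5) + 1 = 4 from rfl] using P.pair (c, 3) (b, 1) hc
  rw [hshift, rowSum, ← sum_add_distrib, ← add_sum_erase _ _ (mem_univ b)]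
  refine Nat.add_le_add_left ((sum_le_card_nsmul _ _ _ fun b _ => hpair b).trans_eq ?_) _
  rw [card_erase_of_mem (mem_univ b), card_univ, ZMod.card, smul_eq_mul]
  ring

theorem eq_of_pos_of_pos (h₂₈ : 28 * q ≤ rowSum x 1 + rowSum x 3 + rowSum x 4)
    (h₃ : 2 * rowSum x 3 ≤ 15 * q) {c₀ : ZMod 5} (hc₀ : ∀ b, 0 < x (b, 1) → x (b + c₀, 4) = 0)
    {a z : ZMod 5} (ha : 0 < x (a, 1)) (hz : 0 < x (z, 4)) {c c' : ZMod 5} (hc : 0 < x (c, 3))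
    (hc' : 0 < x (c', 3)) : c = c' := by
  have hq := P.pos
  let B : Finset (ZMod 5) := {b | x (b, 1) = 0}
  let C : Finset (ZMod 5) := {c | 0 < x (c, 3)}
  let Z : Finset (ZMod 5) := {z | 0 < x (z, 4)}
  have hZ : Z ⊆ B + {c₀} := fun z hz => by
    refine mem_add.2 ⟨z - c₀, mem_filter.2 ⟨mem_univ _, ?_⟩, c₀, mem_singleton_self _, by simp⟩
    by_contra hne
    have := hc₀ _ (Nat.pos_of_ne_zero hne)
    rw [sub_add_cancel] at this
    exact (mem_filter.1 hz).2.ne' this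
  have hBC : B + C ⊆ Z := fun w hw => by
    obtain ⟨b, hb, c, hc, rfl⟩ := mem_add.1 hw
    have := P.rowSum_add_rowSum_le (mem_filter.1 hc).2 b
    rw [(mem_filter.1 hb).2] at this
    exact mem_filter.2 ⟨mem_univ _, by omega⟩
  have hcard : #(B + C) ≤ #B := by
    simpa using card_le_card (hBC.trans hZ)
  obtain ⟨b, hb, -⟩ := mem_add.1 (hZ (mem_filter.2 ⟨mem_univ z, hz⟩))
  have haB : a ∉ B := fun h => ha.ne' (mem_filter.1 h).2
  have hBne : B ≠ univ := fun h => haB (h ▸ mem_univ a)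
  exact card_le_one.1 (card_le_one_of_card_add_le ⟨b, hb⟩ hBne hcard) c (by simp [C, hc]) c'
    (by simp [C, hc'])

theorem exists_ne_pos (h₂₈ : 28 * q ≤ rowSum x 1 + rowSum x 3 + rowSum x 4) {c : ZMod 5}
    (hc : 0 < x (c, 3)) : ∃ c', 0 < x (c', 3) ∧ c' ≠ c := by
  by_contra! h
  have hq := P.pos
  have hsum : rowSum x 3 = x (c, 3) :=
    sum_eq_single c (fun c' _ hne => Nat.eq_zero_of_not_pos (mt (h c') hne)) (by simp)
  have hle := P.le (c, 3)
  have hge : ∀ b, 3 * q ≤ x (b, 1) + x (b + c, 4) := fun b => by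
    have := P.rowSum_add_rowSum_le hc b
    omega
  have h2c : x (c + c, 1) = 0 := by
    by_contra hne
    have hpair := P.pairSum (c, 3) (c, 3) (Nat.pos_of_ne_zero hne)
    have h4 := P.pair (c, 3) (0, 1) hc
    have := P.rowSum_add_rowSum_le hc 0
    simp only [Prod.mk_add_mk, add_zero, zero_add, show (3 : ZMod 5) + 1 = 4 from rfl] at h4 this
    omega
  have h3c := hge (c + c)
  have hdbl : ((c + c + c, 4) + (c + c + c, 4) : Plane) = (c, 3) := by
    clear * -
    decide +revert
  have := P.pairSum (c + c + c, 4) (c + c + c, 4) (by rwa [hdbl])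
  omega

theorem rowSum_lt (h₃ : 2 * rowSum x 3 ≤ 15 * q) {c₀ : ZMod 5}
    (hc₀ : ∀ b, 0 < x (b, 1) → x (b + c₀, 4) = 0)
    (h1 : 0 < rowSum x 1) (h3 : 0 < rowSum x 3) (h4 : 0 < rowSum x 4) :
    rowSum x 1 + rowSum x 3 + rowSum x 4 < 28 * q := by
  by_contra! h₂₈
  obtain ⟨a, -, ha⟩ := sum_pos_iff.1 h1
  obtain ⟨c, -, hc⟩ := sum_pos_iff.1 h3
  obtain ⟨z, -, hz⟩ := sum_pos_iff.1 h4
  obtain ⟨c', hc', hne⟩ := P.exists_ne_pos h₂₈ hc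
  exact hne (P.eq_of_pos_of_pos h₂₈ h₃ hc₀ ha hz hc' hc)

end SumFreeProfile
end Level

section Profile

open Finset Module

variable {G : Type*} [AddCommGroup G]

theorem exists_functional_of_line [Module (ZMod 5) G] {φ : G →ₗ[ZMod 5] Plane}
    (hφ : Function.Surjective φ) {e : Plane} (he : e ≠ 0) (g : Plane) :
    ∃ f : G →ₗ[ZMod 5] ZMod 5, Function.Surjective f ∧ (∀ a, φ a = e → f a = 0) ∧
      ∃ c, ∀ A : Finset G, ∑ k : ZMod 5, #(fibre A φ (g + k • e)) = #(fibre A f c) := by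
  obtain ⟨ψ, hψ⟩ := exists_linearEquiv_apply_eq (K := ZMod 5) he
    (show ((1, 0) : Plane) ≠ 0 by decide)
  refine ⟨LinearMap.snd _ _ _ ∘ₗ ψ.toLinearMap ∘ₗ φ, ?_, fun a ha => ?_, (ψ g).2, fun A => ?_⟩
  · exact (LinearMap.snd_surjective (R := ZMod 5)).comp (ψ.surjective.comp hφ)
  · simp [ha, hψ]
  · have hline : ∀ k : ZMod 5, fibre A φ (g + k • e) = fibre A (ψ ∘ φ) ((ψ g).1 + k, (ψ g).2) := by
      intro k
      ext a
      have : ψ (g + k • e) = ((ψ g).1 + k, (ψ g).2) := by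
        ext <;> simp [hψ]
      simp only [mem_fibre, Function.comp_apply, ← this, ψ.injective.eq_iff]
    simp only [hline]
    exact (Equiv.sum_comp (Equiv.addLeft (ψ g).1)
      fun i => #(fibre A (ψ ∘ φ) (i, (ψ g).2))).trans (sum_card_fibre_prod A (ψ ∘ φ) (ψ g).2)

variable [Finite G]

theorem card_ker_eq_pow {p : ℕ} [Fact p.Prime] [Module (ZMod p) G] {M : Type*} [AddCommGroup M]
    [Module (ZMod p) M] {φ : G →ₗ[ZMod p] M} (hφ : Function.Surjective φ) {e : ℕ}
    (h : finrank (ZMod p) G = finrank (ZMod p) M + e) :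
    Nat.card (LinearMap.ker φ) = p ^ e := by
  have := finrank_eq_of_surjective hφ
  rw [natCard_eq_prime_pow_finrank p]
  congr 1
  omega

variable [Module (ZMod 5) G]

theorem card_ker_plane {d : ℕ} (hG : finrank (ZMod 5) G = d + 3) {φ : G →ₗ[ZMod 5] Plane}
    (hφ : Function.Surjective φ) : Nat.card (LinearMap.ker φ) = 5 ^ (d + 1) :=
  card_ker_eq_pow hφ (by rw [hG, finrank_prod, finrank_self]; omega)

theorem card_ker_functional {d : ℕ} (hG : finrank (ZMod 5) G = d + 3) {f : G →ₗ[ZMod 5] ZMod 5}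
    (hf : Function.Surjective f) : Nat.card (LinearMap.ker f) = 5 ^ (d + 2) :=
  card_ker_eq_pow hf (by rw [hG, finrank_self]; omega)

theorem IsSumFree.sumFreeProfile {A : Finset G} (hA : IsSumFree (A : Set G)) {d : ℕ}
    (hG : finrank (ZMod 5) G = d + 3) {φ : G →ₗ[ZMod 5] Plane} (hφ : Function.Surjective φ) :
    SumFreeProfile (fun g => #(fibre A φ g)) (5 ^ d) where
  pos := pow_pos (by norm_num) d
  pair g h hg := by
    rw [← pow_succ', ← card_ker_plane hG hφ]
    exact hA.card_fibre_pair φ (card_pos.1 hg) h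
  pairSum g h hgh := by
    rw [← pow_succ', ← card_ker_plane hG hφ]
    exact hA.card_fibre_pairSum φ (card_pos.1 hgh)
  triple g h m _ hh hgh hm := by
    rw [← pow_succ']
    exact hA.card_fibre_triple φ (card_ker_plane hG hφ) (card_pos.1 hh) (card_pos.1 hgh) hm
  tripleSum g h m hg hh _ hm := by
    rw [← pow_succ']
    exact hA.card_fibre_tripleSum φ (card_ker_plane hG hφ) (card_pos.1 hg) (card_pos.1 hh) hm
  dir e g he hpos := by
    obtain ⟨a, ha⟩ := card_pos.1 hpos
    obtain ⟨f, hf, hfe, c, hsum⟩ := exists_functional_of_line hφ he g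
    have := hA.mul_card_fibre_le f (mem_fibre.1 ha).1 (hfe a (mem_fibre.1 ha).2) c
    rw [card_ker_functional hG hf, pow_add] at this
    rw [hsum]
    omega

end Profile

section Level

open Finset Module
open scoped Pointwise

/-- The sets to be classified: the large sum-free subsets of an `𝔽₅`-vector space of dimension
`d + 3` that are not contained in a union `{f = 1} ∪ {f = -1}`. -/
structure IsLargeNonNormal {G : Type*} [AddCommGroup G] [Module (ZMod 5) G] (A : Finset G)
    (d : ℕ) : Prop where
  finrank_eq : finrank (ZMod 5) G = d + 3
  sumFree : IsSumFree (A : Set G)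
  card_ge : 28 * 5 ^ d ≤ #A
  exists_mem_ne : ∀ f : G →ₗ[ZMod 5] ZMod 5, ∃ a ∈ A, f a ≠ 1 ∧ f a ≠ 4

namespace IsLargeNonNormal

variable {G : Type*} [AddCommGroup G] [Finite G] [Module (ZMod 5) G] {A : Finset G} {d : ℕ}
  (hA : IsLargeNonNormal A d)
include hA

omit [Finite G] in
theorem card_le_sum_levels (f : G →ₗ[ZMod 5] ZMod 5) :
    28 * 5 ^ d ≤ #(fibre A f 0) + #(fibre A f 1) + #(fibre A f 2) + #(fibre A f 3) +
      #(fibre A f 4) :=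
  hA.card_ge.trans <| (sum_card_fibre A f).ge.trans (Fin.sum_univ_five _).le

theorem levels_of_dense {f : G →ₗ[ZMod 5] ZMod 5} (hf : Function.Surjective f)
    (h : 25 * 5 ^ d < 2 * #(fibre A f 1)) :
    #(fibre A f 0) = 0 ∧ #(fibre A f 2) = 0 ∧ 0 < #(fibre A f 3) ∧ 2 * #(fibre A f 3) ≤ 15 * 5 ^ d ∧
      0 < #(fibre A f 4) := by
  have hker := card_ker_functional hA.finrank_eq hf
  have hpow : 5 ^ (d + 2) = 25 * 5 ^ d ∧ 5 ^ (d + 1) = 5 * 5 ^ d := by constructor <;> ring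
  have h1 := card_fibre_le f A 1
  have h0 : #(fibre A f 0) = 0 := by
    by_contra hne
    have := hA.sumFree.card_fibre_pair f (card_pos.1 (Nat.pos_of_ne_zero hne)) 1
    rw [zero_add] at this
    omega
  have h2 : #(fibre A f 2) = 0 := by
    by_contra hne
    have := hA.sumFree.card_fibre_pairSum f (g := 1) (h := 1) (card_pos.1 (Nat.pos_of_ne_zero hne))
    omega
  have h3 : 0 < #(fibre A f 3) := by
    obtain ⟨a, ha, ha1, ha4⟩ := hA.exists_mem_ne f
    have hfa : a ∈ fibre A f (f a) := mem_fibre.2 ⟨ha, rfl⟩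
    refine card_pos.2 ⟨a, ?_⟩
    rw [card_eq_zero] at h0 h2
    generalize f a = c at *
    fin_cases c
    · exact absurd hfa (h0 ▸ notMem_empty a)
    · exact absurd rfl ha1
    · exact absurd hfa (h2 ▸ notMem_empty a)
    · exact hfa
    · exact absurd rfl ha4
  have htriple : ∀ m, m * 5 ^ (d + 1) < #(fibre A f 1) →
      #(fibre A f 3) + #(fibre A f 3) + m * 5 ^ (d + 1) ≤ 5 ^ (d + 2) := fun m hm =>
    hA.sumFree.card_fibre_tripleSum f (g := 3) (h := 3) hker (card_pos.1 h3) (card_pos.1 h3) hm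
  refine ⟨h0, h2, h3, by have := htriple 2 (by omega); omega, Nat.pos_of_ne_zero fun h4 => ?_⟩
  have := hA.card_le_sum_levels f
  have := htriple 2 (by omega)
  have := htriple 4 (by omega)
  omega

/-- If `A` is dense on `{f = 1}`, then on the level `{f = 4}` it avoids the sum of the other two
levels, which contains large cosets; they are the fibres of a plane projection. -/
theorem exists_projection_of_dense {f : G →ₗ[ZMod 5] ZMod 5} (hf : Function.Surjective f)
    (h : 25 * 5 ^ d < 2 * #(fibre A f 1)) :
    ∃ g : G →ₗ[ZMod 5] ZMod 5, Function.Surjective (g.prod f) ∧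
      ∃ c₀, ∀ b, 0 < #(fibre A (g.prod f) (b, 1)) → #(fibre A (g.prod f) (b + c₀, 4)) = 0 := by
  classical
  have := hA.finrank_eq
  have hker := finrank_eq_of_surjective hf
  rw [hA.finrank_eq, finrank_self] at hker
  obtain ⟨h0, h2, h3, -, h4⟩ := hA.levels_of_dense hf h
  have hadd := hA.sumFree.card_fibre_add f 1 3
  rw [show (1 + 3 : ZMod 5) = 4 from rfl, card_ker_functional hA.finrank_eq hf, pow_add] at hadd
  have hcard := hA.card_le_sum_levels f
  obtain ⟨K, hK, hfin, S, hS, hstab, ⟨y, hy, hyS⟩, -⟩ :=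
    exists_submodule_stable (p := 5) (e := d + 1) (X := fibre A f 1) (Y := fibre A f 3)
      (card_pos.1 (by omega)) (card_pos.1 h3) (W := LinearMap.ker f) sub_mem_ker_of_mem_fibre
      (by omega) (by omega)
  obtain ⟨g, hg⟩ := exists_ker_prod_eq hK (by omega)
  have hgf : LinearMap.ker (g.prod f) = K := by
    rw [← hg, LinearMap.ker_prod, LinearMap.ker_prod, inf_comm]
  refine ⟨g, surjective_of_finrank_eq ?_, g y, fun b hb => card_eq_zero.2 <|
    eq_empty_of_forall_notMem fun z hz => ?_⟩
  · rw [hgf, hfin, hA.finrank_eq, finrank_prod, finrank_self]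
    omega
  · obtain ⟨a, ha⟩ := card_pos.1 hb
    obtain ⟨haA, hga, hfa⟩ : a ∈ A ∧ g a = b ∧ f a = 1 := by
      simpa [mem_fibre] using ha
    obtain ⟨hzA, hgz, hfz⟩ : z ∈ A ∧ g z = b + g y ∧ f z = 4 := by
      simpa [mem_fibre] using hz
    have hk : z - (a + y) ∈ K := by
      rw [← hgf, LinearMap.sub_mem_ker_iff]
      simp [hga, hgz, hfa, hfz, (mem_fibre.1 hy).2, show (1 + 3 : ZMod 5) = 4 from rfl]
    have hzS := hS (hstab _ hk _ (hyS a (mem_fibre.2 ⟨haA, hfa⟩)))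
    rw [sub_add_cancel] at hzS
    obtain ⟨u, hu, v, hv, rfl⟩ := mem_add.1 hzS
    exact hA.sumFree u (mem_fibre.1 hu).1 v (mem_fibre.1 hv).1 hzA

theorem two_mul_card_level_one_le {f : G →ₗ[ZMod 5] ZMod 5} (hf : Function.Surjective f) :
    2 * #(fibre A f 1) ≤ 25 * 5 ^ d := by
  by_contra! h
  obtain ⟨h0, h2, h3, h3', h4⟩ := hA.levels_of_dense hf h
  obtain ⟨g, hgf, c₀, hc₀⟩ := hA.exists_projection_of_dense hf h
  have hrow : ∀ j, rowSum (fun p => #(fibre A (g.prod f) p)) j = #(fibre A f j) :=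
    sum_card_fibre_prod A (g.prod f)
  have hlt := (hA.sumFree.sumFreeProfile hA.finrank_eq hgf).rowSum_lt (by rwa [hrow]) hc₀
    (by rw [hrow]; omega) (by rwa [hrow]) (by rwa [hrow])
  rw [hrow, hrow, hrow] at hlt
  have := hA.card_le_sum_levels f
  omega

theorem two_mul_card_level_le {f : G →ₗ[ZMod 5] ZMod 5} (hf : Function.Surjective f) (c : ZMod 5) :
    2 * #(fibre A f c) ≤ 25 * 5 ^ d := by
  rcases eq_or_ne c 0 with rfl | hc
  · rcases (fibre A f 0).eq_empty_or_nonempty with h | ⟨a, ha⟩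
    · simp [h]
    · have := hA.sumFree.mul_card_fibre_le f (mem_fibre.1 ha).1 (mem_fibre.1 ha).2 0
      rw [card_ker_functional hA.finrank_eq hf, pow_add] at this
      omega
  · have hlevel : fibre A f c = fibre A (c⁻¹ • f) 1 := by
      ext a
      rw [mem_fibre, mem_fibre, LinearMap.smul_apply, smul_eq_mul, inv_mul_eq_one₀ hc, eq_comm]
    rw [hlevel]
    exact hA.two_mul_card_level_one_le ((mul_left_surjective₀ (inv_ne_zero hc)).comp hf)

theorem profile {φ : G →ₗ[ZMod 5] Plane} (hφ : Function.Surjective φ) :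
    Profile (fun g => #(fibre A φ g)) (5 ^ d) where
  toSumFreeProfile := hA.sumFree.sumFreeProfile hA.finrank_eq hφ
  line e g he := by
    obtain ⟨f, hf, -, c, hsum⟩ := exists_functional_of_line hφ he g
    rw [hsum]
    exact hA.two_mul_card_level_le hf c
  total := hA.card_ge.trans (sum_card_fibre A φ).ge

end IsLargeNonNormal
end Level

section Flat

open Finset Module AddAction
open scoped Pointwise

theorem Profile.isExceptional_of_four_mul_lt {x : Plane → ℕ} {q : ℕ} (P : Profile x q) {g : Plane}
    (h : 4 * q < x g) : IsExceptional x := by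
  have hg : g ≠ 0 := by
    rintro rfl
    have := P.pair 0 0 (by omega)
    rw [zero_add] at this
    omega
  obtain ⟨ψ, hψ⟩ := exists_linearEquiv_apply_eq (K := ZMod 5) (show ((1, 0) : Plane) ≠ 0 by decide)
    hg
  exact .of_comp ((P.comp ψ).isExceptional_of_dense (by rwa [Function.comp_apply, hψ]))

/-- Translation by `-x` maps `A ∩ {φ = g + h}` into the complement of `A` in `{φ = g}`; if the
latter is not larger then this is a bijection. -/
theorem IsSumFree.add_mem_fibre {R G M : Type*} [Ring R] [AddCommGroup G] [Fintype G]
    [DecidableEq G] [Module R G] [AddCommGroup M] [Module R M] (φ : G →ₗ[R] M) {A : Finset G}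
    (hA : IsSumFree (A : Set G)) {g h : M} (hcard : #(fibre Aᶜ φ g) ≤ #(fibre A φ (g + h)))
    {x : G} (hx : x ∈ fibre A φ h) {v : G} (hv : v ∈ fibre Aᶜ φ g) : v + x ∈ fibre A φ (g + h) := by
  rw [mem_fibre] at hx
  have hsub : (fibre A φ (g + h)).image (· - x) ⊆ fibre Aᶜ φ g := image_subset_iff.2 fun y hy => by
    rw [mem_fibre] at hy
    refine mem_fibre.2 ⟨mem_compl.2 fun hyx => hA _ hyx x hx.1 (by simpa using hy.1), ?_⟩
    rw [map_sub, hx.2, hy.2, add_sub_cancel_right]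
  have heq := eq_of_subset_of_card_le hsub
    (hcard.trans_eq (card_image_of_injective _ sub_left_injective).symm)
  obtain ⟨y, hy, rfl⟩ := mem_image.1 (heq ▸ hv)
  rwa [sub_add_cancel]

theorem exists_submodule_of_forall_add_mem {p d : ℕ} [Fact p.Prime] {G : Type*} [AddCommGroup G]
    [Finite G] [Module (ZMod p) G] {X D : Finset G} (hX : #X = p ^ (d + 1)) (hD : p ^ d ≤ #D)
    (h0 : 0 ∉ D) (h : ∀ v ∈ D, ∀ x ∈ X, v + x ∈ X) :
    ∃ U : Submodule (ZMod p) G, finrank (ZMod p) U = d + 1 ∧ ∀ u ∈ U, ∀ x ∈ X, u + x ∈ X := by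
  classical
  let K := stabilizer G X
  have hp : p.Prime := Fact.out
  have hmem : ∀ v ∈ insert 0 D, v ∈ K := fun v hv => (mem_insert.1 hv).elim
    (fun h => h ▸ K.zero_mem) fun hv => mem_stabilizer_finset'.2 fun x hx => h v hv x hx
  have hlt : p ^ d < Nat.card K := by
    have := card_le_of_sub_mem fun v hv w hw => K.sub_mem (hmem v hv) (hmem w hw)
    rw [card_insert_of_notMem h0] at this
    omega
  obtain ⟨k, hk, hcard⟩ := (Nat.dvd_prime_pow hp).1 (hX ▸ card_dvd_card_of_le_stabilizer le_rfl)
  let U := AddSubgroup.toZModSubmodule p K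
  refine ⟨U, ?_, fun u hu x hx => mem_stabilizer_finset'.1 hu hx⟩
  have hU : Nat.card K = p ^ finrank (ZMod p) U := natCard_eq_prime_pow_finrank p U
  rw [hcard, Nat.pow_lt_pow_iff_right hp.one_lt] at hlt
  rw [hcard, Nat.pow_right_inj hp.one_lt] at hU
  omega

namespace IsLargeNonNormal

variable {G : Type*} [AddCommGroup G] [Module (ZMod 5) G] {A : Finset G} {d : ℕ}
  (hA : IsLargeNonNormal A d)
include hA

theorem exists_projection [Finite G] {U : Submodule (ZMod 5) G} (hU : finrank (ZMod 5) U = d + 1)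
    {t : G} (ht : 3 * 5 ^ d < #(fibre A U.mkQ (U.mkQ t))) :
    ∃ φ : G →ₗ[ZMod 5] Plane, Function.Surjective φ ∧
      fibre A φ (1, 0) = fibre A U.mkQ (U.mkQ t) := by
  have htU : t ∉ U := fun h => by
    rw [show U.mkQ t = 0 from (Submodule.Quotient.mk_eq_zero U).2 h] at ht
    obtain ⟨a, ha⟩ := card_pos.1 (Nat.zero_lt_of_lt ht)
    have := hA.sumFree.mul_card_fibre_le U.mkQ (mem_fibre.1 ha).1 (mem_fibre.1 ha).2 0
    rw [U.ker_mkQ, natCard_eq_prime_pow_finrank 5, hU] at this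
    omega
  obtain ⟨φ, hφ, hker, hφt⟩ := exists_ker_eq_apply_eq (U := U) (W := Plane)
    (by rw [hU, hA.finrank_eq, finrank_prod, finrank_self]; omega) htU
    (show ((1, 0) : Plane) ≠ 0 by decide)
  refine ⟨φ, hφ, ?_⟩
  ext a
  rw [mem_fibre, mem_fibre, ← hφt, ← LinearMap.sub_mem_ker_iff, hker, ← LinearMap.sub_mem_ker_iff,
    U.ker_mkQ]

/-- In this case the part of `A` at height `1` is a coset of a subspace. -/
theorem exists_flat_of_sparse [Finite G] {φ : G →ₗ[ZMod 5] Plane} (hφ : Function.Surjective φ)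
    (hdense : #(fibre A φ (1, 0)) = 4 * 5 ^ d)
    (hsparse : ∀ i j, j ≠ 0 → #(fibre A φ (i, j)) = 5 ^ d) :
    ∃ U : Submodule (ZMod 5) G, finrank (ZMod 5) U = d + 1 ∧
      ∃ t, 4 * 5 ^ d < #(fibre A U.mkQ (U.mkQ t)) := by
  classical
  have := Fintype.ofFinite G
  let X := fibre A (Prod.snd ∘ φ) 1
  have hX : #X = 5 ^ (d + 1) := by
    rw [← sum_card_fibre_prod A φ 1, sum_congr rfl fun i _ => hsparse i 1 one_ne_zero]
    simp [pow_succ']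
  have hD : #(fibre Aᶜ φ (1, 0)) = 5 ^ d := by
    have := card_fibre_add_card_fibre_compl A hφ (1, 0)
    rw [card_ker_plane hA.finrank_eq hφ, pow_succ'] at this
    omega
  have hDX : ∀ v ∈ fibre Aᶜ φ (1, 0), ∀ x ∈ X, v + x ∈ X := fun v hv x hx => by
    obtain ⟨hxA, hx1⟩ := mem_fibre.1 hx
    have hφx : φ x = ((φ x).1, 1) := Prod.ext rfl hx1
    have hle : #(fibre Aᶜ φ (1, 0)) ≤ #(fibre A φ ((1, 0) + ((φ x).1, 1))) := by
      rw [hD, Prod.mk_add_mk, zero_add, hsparse _ _ one_ne_zero]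
    obtain ⟨hA', hφ'⟩ := mem_fibre.1 (hA.sumFree.add_mem_fibre φ hle (mem_fibre.2 ⟨hxA, hφx⟩) hv)
    exact mem_fibre.2 ⟨hA', by simp [hφ']⟩
  obtain ⟨U, hU, hUX⟩ := exists_submodule_of_forall_add_mem hX hD.ge
    (fun h => absurd ((map_zero φ).symm.trans (mem_fibre.1 h).2) (by decide)) hDX
  obtain ⟨t, ht⟩ : X.Nonempty := card_pos.1 (by rw [hX]; positivity)
  refine ⟨U, hU, t, ?_⟩
  have hcoset : fibre A U.mkQ (U.mkQ t) = fibre univ U.mkQ (U.mkQ t) := by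
    ext a
    refine ⟨fun ha => mem_fibre.2 ⟨mem_univ a, (mem_fibre.1 ha).2⟩, fun ha => ?_⟩
    have hat := hUX (a - t) ((Submodule.Quotient.eq U).1 (mem_fibre.1 ha).2) t ht
    rw [sub_add_cancel] at hat
    exact mem_fibre.2 ⟨(mem_fibre.1 hat).1, (mem_fibre.1 ha).2⟩
  rw [hcoset, card_fibre_univ U.mkQ_surjective, U.ker_mkQ, natCard_eq_prime_pow_finrank 5, hU,
    pow_succ']
  have := pow_pos (show 0 < 5 by norm_num) d
  omega

theorem exists_isExceptional [Finite G] {U : Submodule (ZMod 5) G}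
    (hU : finrank (ZMod 5) U = d + 1) {t : G} (ht : 3 * 5 ^ d < #(fibre A U.mkQ (U.mkQ t))) :
    ∃ φ : G →ₗ[ZMod 5] Plane, Function.Surjective φ ∧ IsExceptional fun g => #(fibre A φ g) := by
  obtain ⟨φ, hφ, hφt⟩ := hA.exists_projection hU ht
  have P := hA.profile hφ
  by_cases hle : ∀ g, #(fibre A φ g) ≤ 4 * 5 ^ d
  · rcases P.isExceptional_or_eq hle (by rwa [hφt]) with h | ⟨hdense, hsparse⟩
    · exact ⟨φ, hφ, h⟩
    · obtain ⟨U', hU', t', ht'⟩ := hA.exists_flat_of_sparse hφ hdense hsparse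
      obtain ⟨ψ, hψ, hψt⟩ := hA.exists_projection hU' (t := t') (by omega)
      exact ⟨ψ, hψ, (hA.profile hψ).isExceptional_of_dense (by rwa [hψt])⟩
  · push Not at hle
    obtain ⟨g, hg⟩ := hle
    exact ⟨φ, hφ, P.isExceptional_of_four_mul_lt hg⟩

theorem exists_support_eq [Finite G] {U : Submodule (ZMod 5) G}
    (hU : finrank (ZMod 5) U = d + 1) {t : G} (ht : 3 * 5 ^ d < #(fibre A U.mkQ (U.mkQ t))) :
    ∃ φ : G →ₗ[ZMod 5] Plane, Function.Surjective φ ∧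
      (∀ a ∈ A, φ a ∈ axisPoints ∨ φ a ∈ halfPoints) ∧
      ∀ g ∈ halfPoints, (fibre A φ g).Nonempty := by
  obtain ⟨φ, hφ, ψ, hsupp, hhalf⟩ := hA.exists_isExceptional hU ht
  refine ⟨ψ.symm.toLinearMap ∘ₗ φ, ψ.symm.surjective.comp hφ, fun a ha => hsupp _ ?_,
    fun g hg => ?_⟩
  · exact card_pos.2 ⟨a, mem_fibre.2 ⟨ha, by simp⟩⟩
  · obtain ⟨a, ha⟩ := card_pos.1 (hhalf g hg)
    exact ⟨a, mem_fibre.2 ⟨(mem_fibre.1 ha).1, by simp [(mem_fibre.1 ha).2]⟩⟩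

end IsLargeNonNormal
end Flat

/-! ### Reconstruction of `Λ` -/

section Exceptional

open Finset Module
open scoped Pointwise

/-- The fibres of the projection of `Λ` to the plane of its first two coordinates. -/
def lambdaFibre (g : Plane) : Finset (ZMod 5) :=
  if g ∈ axisPoints then univ
  else if g = (2, 1) then {1, 2}
  else if g = (4, 2) then {0, 1}
  else if g = (1, 3) then {0, 4}
  else if g = (3, 4) then {3, 4}
  else ∅

theorem mem_Lambda_iff (u : Fin 3 → ZMod 5) : u ∈ Lambda ↔ u 2 ∈ lambdaFibre (u 0, u 1) := by
  have hvec : ∀ a b c : ZMod 5, u = ![a, b, c] ↔ u 0 = a ∧ u 1 = b ∧ u 2 = c := fun a b c => by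
    rw [← List.ofFn_inj]
    simp
  simp only [Lambda, Set.mem_union, Set.mem_ofPred_eq, Set.mem_insert_iff, Set.mem_singleton_iff,
    hvec, exists_or, exists_and_left, exists_eq', and_true]
  generalize u 0 = a, u 1 = b, u 2 = c
  revert a b c
  set_option synthInstance.maxSize 1000 in decide

theorem card_lambdaFibre_of_mem_axisPoints : ∀ g ∈ axisPoints, #(lambdaFibre g) = 5 := by decide

theorem card_lambdaFibre_of_mem_halfPoints : ∀ g ∈ halfPoints, #(lambdaFibre g) = 2 := by decide

theorem lambdaFibre_eq_empty : ∀ g, g ∉ axisPoints ++ halfPoints → lambdaFibre g = ∅ := by decide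

theorem compl_lambdaFibre_subset_add :
    ∀ g ∈ halfPoints, ∀ c ∉ lambdaFibre (g + g), c ∈ lambdaFibre g + lambdaFibre g := by
  decide

theorem Profile.eq_of_support {x : Plane → ℕ} {q : ℕ} (P : Profile x q)
    (hsupp : ∀ g, g ∉ axisPoints ++ halfPoints → x g = 0) (hhalf : ∀ g ∈ halfPoints, 0 < x g) :
    (∀ g ∈ axisPoints, x g = 5 * q) ∧ ∀ g ∈ halfPoints, x g = 2 * q := by
  have hsum : 28 * q ≤ ((axisPoints ++ halfPoints).map x).sum := by
    rw [← List.sum_toFinset x (by decide), sum_subset (subset_univ _) fun g _ hg =>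
      hsupp g (List.mem_toFinset.not.1 hg)]
    exact P.total
  have hdouble : ∀ g ∈ halfPoints, x g + x g + x (g + g) ≤ 6 * q := fun g hg =>
    P.triple_le (hhalf g hg) (hhalf g hg)
      (hhalf _ ((show ∀ g ∈ halfPoints, g + g ∈ halfPoints by decide) g hg))
  have h₁ : x (2, 1) + x (2, 1) + x (4, 2) ≤ 6 * q := hdouble (2, 1) (by decide)
  have h₂ : x (4, 2) + x (4, 2) + x (3, 4) ≤ 6 * q := hdouble (4, 2) (by decide)
  have h₃ : x (3, 4) + x (3, 4) + x (1, 3) ≤ 6 * q := hdouble (3, 4) (by decide)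
  have h₄ : x (1, 3) + x (1, 3) + x (2, 1) ≤ 6 * q := hdouble (1, 3) (by decide)
  have hle : ∀ g ∈ axisPoints, x g ≤ 5 * q := fun g _ => P.le g
  simp only [axisPoints, halfPoints, List.cons_append, List.nil_append, List.map_cons, List.map_nil,
    List.sum_cons, List.sum_nil, List.forall_mem_cons, List.not_mem_nil, IsEmpty.forall_iff,
    implies_true, and_true] at hsum hle ⊢
  omega

theorem Profile.eq_card_lambdaFibre_mul {x : Plane → ℕ} {q : ℕ} (P : Profile x q)
    (hsupp : ∀ g, 0 < x g → g ∈ axisPoints ∨ g ∈ halfPoints)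
    (hhalf : ∀ g ∈ halfPoints, 0 < x g) (g : Plane) : x g = #(lambdaFibre g) * q := by
  have hzero : ∀ g, g ∉ axisPoints ++ halfPoints → x g = 0 := fun g hg =>
    Nat.eq_zero_of_not_pos fun h => hg (List.mem_append.2 (hsupp g h))
  obtain ⟨haxis, hhalf⟩ := P.eq_of_support hzero hhalf
  by_cases hg : g ∈ axisPoints ++ halfPoints
  · rcases List.mem_append.1 hg with hg | hg
    · rw [haxis g hg, card_lambdaFibre_of_mem_axisPoints g hg]
    · rw [hhalf g hg, card_lambdaFibre_of_mem_halfPoints g hg]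
  · rw [hzero g hg, lambdaFibre_eq_empty g hg, card_empty, zero_mul]

theorem mem_iff_of_card_le {R G M N : Type*} [Ring R] [AddCommGroup G] [Finite G] [Module R G]
    [AddCommGroup M] [Module R M] [AddCommGroup N] [Module R N] {A : Finset G} {φ : G →ₗ[R] M}
    {h : G →ₗ[R] N} (hφh : Function.Surjective (φ.prod h)) {g : M} {T : Finset N}
    (hsub : ∀ z ∈ A, φ z = g → h z ∈ T)
    (hcard : #T * Nat.card (LinearMap.ker (φ.prod h)) ≤ #(fibre A φ g)) {z : G} (hz : φ z = g) :
    z ∈ A ↔ h z ∈ T := by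
  classical
  have := Fintype.ofFinite G
  have hmem : ∀ z, φ.prod h z ∈ ({g} : Finset M) ×ˢ T ↔ φ z = g ∧ h z ∈ T := fun z => by
    rw [mem_product, mem_singleton]
    rfl
  have hle : fibre A φ g ⊆ ({z | φ.prod h z ∈ ({g} : Finset M) ×ˢ T} : Finset G) := fun z hz => by
    obtain ⟨hzA, hzg⟩ := mem_fibre.1 hz
    exact mem_filter.2 ⟨mem_univ _, (hmem z).2 ⟨hzg, hsub z hzA hzg⟩⟩
  have heq := eq_of_subset_of_card_le hle <| by
    rwa [card_filter_mem hφh, card_product, card_singleton, one_mul]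
  refine ⟨fun hzA => hsub z hzA hz, fun hzT => ?_⟩
  have hz' : z ∈ fibre A φ g := heq ▸ mem_filter.2 ⟨mem_univ z, (hmem z).2 ⟨hz, hzT⟩⟩
  exact (mem_fibre.1 hz').1

/-- If `A` contains the points of `{φ = g}` with heights in `S` then it avoids those of
`{φ = g + g}` with heights in `S + S`. -/
theorem IsSumFree.mem_iff_of_compl_subset_add {R G M N : Type*} [Ring R] [AddCommGroup G]
    [Finite G] [Module R G] [AddCommGroup M] [Module R M] [AddCommGroup N] [DecidableEq N]
    [Module R N] {A : Finset G} (hA : IsSumFree (A : Set G)) {φ : G →ₗ[R] M} {h : G →ₗ[R] N}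
    (hφh : Function.Surjective (φ.prod h)) {g : M} {S T : Finset N}
    (hS : ∀ z, φ z = g → h z ∈ S → z ∈ A) (hST : ∀ c ∉ T, c ∈ S + S)
    (hcard : #T * Nat.card (LinearMap.ker (φ.prod h)) ≤ #(fibre A φ (g + g))) {z : G}
    (hz : φ z = g + g) : z ∈ A ↔ h z ∈ T := by
  refine mem_iff_of_card_le hφh (fun w hwA hwg => ?_) hcard hz
  by_contra hT
  obtain ⟨s, hs, s', hs', hss'⟩ := mem_add.1 (hST _ hT)
  obtain ⟨u, hu⟩ := hφh (g, s)
  obtain ⟨hug, hus⟩ : φ u = g ∧ h u = s := Prod.ext_iff.1 hu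
  refine hA u (hS u hug (hus ▸ hs)) (w - u) (hS _ ?_ ?_) (by rwa [add_sub_cancel])
  · rw [map_sub, hwg, hug, add_sub_cancel_right]
  · rwa [map_sub, ← hss', hus, add_sub_cancel_left]

variable {G : Type*} [AddCommGroup G] [Finite G] [Module (ZMod 5) G] {A : Finset G} {d : ℕ}

theorem IsSumFree.exists_stable_double (hA : IsSumFree (A : Set G))
    (hG : finrank (ZMod 5) G = d + 3) {φ : G →ₗ[ZMod 5] Plane} (hφ : Function.Surjective φ)
    {g : Plane} (hg : #(fibre A φ g) = 2 * 5 ^ d) (hgg : #(fibre A φ (g + g)) = 2 * 5 ^ d) :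
    ∃ K ≤ LinearMap.ker φ, finrank (ZMod 5) K = d ∧
      ∀ z, φ z = g + g → ∀ a ∈ A, φ a = g + g → z - a ∈ K → z ∈ A := by
  classical
  have := Fintype.ofFinite G
  have hpos := pow_pos (show 0 < 5 by norm_num) d
  have hker := card_ker_plane hG hφ
  have hadd := hA.card_fibre_add φ g g
  have hne : (fibre A φ g).Nonempty := card_pos.1 (by omega)
  obtain ⟨K, hK, hfin, S, hS, hstab, -, hcard⟩ :=
    exists_submodule_stable (p := 5) (e := d) hne hne sub_mem_ker_of_mem_fibre
      (by rw [pow_succ'] at hker ⊢; omega) (by rw [pow_succ'] at hker; omega)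
  refine ⟨K, hK, hfin, fun z hz a ha _ hza => ?_⟩
  have hSA : ∀ s ∈ S, s ∉ A := fun s hs hsA => by
    obtain ⟨u, hu, v, hv, rfl⟩ := mem_add.1 (hS hs)
    exact hA u (mem_fibre.1 hu).1 v (mem_fibre.1 hv).1 hsA
  have hdisj : Disjoint S (fibre A φ (g + g)) :=
    disjoint_left.2 fun s hs hsA => hSA s hs (mem_fibre.1 hsA).1
  have hcover : S ∪ fibre A φ (g + g) = fibre univ φ (g + g) := by
    refine eq_of_subset_of_card_le (union_subset (fun s hs => ?_) ?_) ?_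
    · obtain ⟨u, hu, v, hv, rfl⟩ := mem_add.1 (hS hs)
      exact mem_fibre.2 ⟨mem_univ _, by rw [map_add, (mem_fibre.1 hu).2, (mem_fibre.1 hv).2]⟩
    · exact fun a ha => mem_fibre.2 ⟨mem_univ a, (mem_fibre.1 ha).2⟩
    · rw [card_fibre_univ hφ, card_union_of_disjoint hdisj, hker, pow_succ']
      omega
  rcases mem_union.1 (hcover ▸ mem_fibre.2 ⟨mem_univ z, hz⟩) with hzS | hzA
  · have := hstab _ (K.sub_mem K.zero_mem hza) z hzS
    rw [zero_sub, neg_sub, sub_add_cancel] at this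
    exact absurd ha (hSA a this)
  · exact (mem_fibre.1 hzA).1

theorem IsSumFree.exists_coordinate (hA : IsSumFree (A : Set G))
    (hG : finrank (ZMod 5) G = d + 3) {φ : G →ₗ[ZMod 5] Plane} (hφ : Function.Surjective φ)
    {g : Plane} (hg : #(fibre A φ g) = 2 * 5 ^ d) (hgg : #(fibre A φ (g + g)) = 2 * 5 ^ d)
    (hne : g + g ≠ 0) :
    ∃ h : G →ₗ[ZMod 5] ZMod 5, Function.Surjective (φ.prod h) ∧
      ∀ z, φ z = g + g → h z ∈ ({0, 1} : Finset (ZMod 5)) → z ∈ A := by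
  obtain ⟨K, hK, hfin, hmem⟩ := hA.exists_stable_double hG hφ hg hgg
  have hker : finrank (ZMod 5) (LinearMap.ker φ) = finrank (ZMod 5) K + 1 := by
    have := finrank_eq_of_surjective hφ
    rw [hG, finrank_prod, finrank_self] at this
    omega
  have hpos := pow_pos (show 0 < 5 by norm_num) d
  obtain ⟨w, hw⟩ := card_pos.1 (show 0 < #(fibre A φ (g + g)) by omega)
  obtain ⟨v, hv, hvw⟩ : ∃ v ∈ fibre A φ (g + g), v - w ∉ K := by
    by_contra! h
    have := card_le_of_sub_mem (K := K.toAddSubgroup) fun y hy z hz => by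
      simpa using K.sub_mem (h y hy) (h z hz)
    have hcard : Nat.card K.toAddSubgroup = 5 ^ d := hfin ▸ natCard_eq_prime_pow_finrank 5 K
    omega
  obtain ⟨hwA, hwg⟩ := mem_fibre.1 hw
  obtain ⟨hvA, hvg⟩ := mem_fibre.1 hv
  obtain ⟨h, hh, hhw, hhv⟩ :=
    exists_ker_prod_eq_apply_eq hK hker (hvg.trans hwg.symm) (by rwa [hwg]) hvw
  have hsub : ∀ z a, φ z = φ a → h z = h a → z - a ∈ K := fun z a hφz hhz => by
    rw [← hh, LinearMap.sub_mem_ker_iff]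
    exact Prod.ext hφz hhz
  refine ⟨h, surjective_of_finrank_eq ?_, fun z hz hhz => ?_⟩
  · rw [hh, hfin, hG, finrank_prod, finrank_prod, finrank_self, add_comm]
  · rcases mem_insert.1 hhz with h0 | h1
    · exact hmem z hz w hwA hwg (hsub z w (hz.trans hwg.symm) (h0.trans hhw.symm))
    · exact hmem z hz v hvA hvg (hsub z v (hz.trans hvg.symm) ((mem_singleton.1 h1).trans hhv.symm))

theorem IsLargeNonNormal.exists_mem_iff_mem_lambdaFibre (hA : IsLargeNonNormal A d)
    {φ : G →ₗ[ZMod 5] Plane} (hφ : Function.Surjective φ)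
    (hsupp : ∀ a ∈ A, φ a ∈ axisPoints ∨ φ a ∈ halfPoints)
    (hhalf : ∀ g ∈ halfPoints, (fibre A φ g).Nonempty) :
    ∃ h : G →ₗ[ZMod 5] ZMod 5, Function.Surjective (φ.prod h) ∧
      ∀ z, z ∈ A ↔ h z ∈ lambdaFibre (φ z) := by
  have hcard : ∀ g, #(fibre A φ g) = #(lambdaFibre g) * 5 ^ d :=
    (hA.profile hφ).eq_card_lambdaFibre_mul
      (fun g hg => by
        obtain ⟨a, ha⟩ := card_pos.1 hg
        exact (mem_fibre.1 ha).2 ▸ hsupp a (mem_fibre.1 ha).1)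
      fun g hg => card_pos.2 (hhalf g hg)
  obtain ⟨h, hφh, h42⟩ := hA.sumFree.exists_coordinate hA.finrank_eq hφ (g := (2, 1))
    (hcard (2, 1)) (hcard ((2, 1) + (2, 1))) (by decide)
  have hker : Nat.card (LinearMap.ker (φ.prod h)) = 5 ^ d := by
    have := finrank_eq_of_surjective hφh
    rw [hA.finrank_eq, finrank_prod, finrank_prod, finrank_self] at this
    rw [natCard_eq_prime_pow_finrank 5]
    congr 1
    omega
  have hstep : ∀ g ∈ halfPoints, (∀ z, φ z = g → h z ∈ lambdaFibre g → z ∈ A) →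
      ∀ z, φ z = g + g → (z ∈ A ↔ h z ∈ lambdaFibre (g + g)) := fun g hg hS z hz =>
    hA.sumFree.mem_iff_of_compl_subset_add hφh hS (compl_lambdaFibre_subset_add g hg)
      (by rw [hker, hcard]) hz
  have h34 := hstep (4, 2) (by decide) h42
  have h13 := hstep (3, 4) (by decide) fun z hz => (h34 z hz).2
  have h21 := hstep (1, 3) (by decide) fun z hz => (h13 z hz).2
  have h42 := hstep (2, 1) (by decide) fun z hz => (h21 z hz).2
  refine ⟨h, hφh, fun z => ?_⟩
  by_cases hz : φ z ∈ halfPoints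
  · simp only [halfPoints, List.mem_cons, List.not_mem_nil, or_false] at hz
    rcases hz with hz | hz | hz | hz <;> rw [hz]
    exacts [h21 z hz, h42 z hz, h13 z hz, h34 z hz]
  · refine mem_iff_of_card_le hφh (fun w hwA hwz => ?_) (by rw [hker, hcard]) rfl
    have hw : φ z ∈ axisPoints := hwz ▸ (hsupp w hwA).resolve_right (hwz ▸ hz)
    rw [lambdaFibre, if_pos hw]
    exact mem_univ _

end Exceptional

section Affine

open Finset Module

variable {n : ℕ}

theorem isVLSet_of_forall_mem_iff (hn : 3 ≤ n) {A : Set (Fin n → ZMod 5)}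
    {φ : (Fin n → ZMod 5) →ₗ[ZMod 5] Plane} {h : (Fin n → ZMod 5) →ₗ[ZMod 5] ZMod 5}
    (hφh : Function.Surjective (φ.prod h)) (hA : ∀ z, z ∈ A ↔ h z ∈ lambdaFibre (φ z)) :
    IsVLSet A := by
  let Φ : (Fin n → ZMod 5) →ₗ[ZMod 5] Fin 3 → ZMod 5 :=
    LinearMap.pi ![LinearMap.fst _ _ _ ∘ₗ φ, LinearMap.snd _ _ _ ∘ₗ φ, h]
  have hΦ : Function.Surjective Φ := fun u => by
    obtain ⟨z, hz⟩ := hφh ((u 0, u 1), u 2)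
    obtain ⟨hzφ, hzh⟩ : φ z = (u 0, u 1) ∧ h z = u 2 := Prod.ext_iff.1 hz
    refine ⟨z, funext fun i => ?_⟩
    fin_cases i
    exacts [congrArg Prod.fst hzφ, congrArg Prod.snd hzφ, hzh]
  obtain ⟨e, he⟩ := exists_linearEquiv_prod (U := Fin (n - 3) → ZMod 5) hΦ
    (by simp only [finrank_fin_fun]; omega)
  refine ⟨e, Set.ext fun u => ?_⟩
  rw [← e.coe_toEquiv, Equiv.image_eq_preimage_symm]
  obtain ⟨z, rfl⟩ := e.surjective u
  have hz : z ∈ A ↔ Φ z ∈ Lambda := (hA z).trans (mem_Lambda_iff (Φ z)).symm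
  simp [hz, he]

theorem isNormalSumFree_of_functional {A : Set (Fin n → ZMod 5)} (hA : IsSumFree A)
    (hne : A.Nonempty) {f : (Fin n → ZMod 5) →ₗ[ZMod 5] ZMod 5}
    (hf : ∀ a ∈ A, f a = 1 ∨ f a = 4) : IsNormalSumFree A := by
  have hneg : ∀ {a}, f a = 4 → f (-a) = 1 := fun h => by rw [map_neg, h]; decide
  obtain ⟨p, hp⟩ : ∃ p, f p = 1 := by
    obtain ⟨a, ha⟩ := hne
    exact (hf a ha).elim (fun h => ⟨a, h⟩) fun h => ⟨-a, hneg h⟩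
  have hmem : ∀ x, x ∈ AffineSubspace.mk' p (LinearMap.ker f) ↔ f x = 1 := fun x => by
    rw [AffineSubspace.mem_mk', LinearMap.mem_ker, vsub_eq_sub, map_sub, hp, sub_eq_zero]
  have hsurj : Function.Surjective f := fun c =>
    ⟨c • p, by rw [map_smul, hp, smul_eq_mul, mul_one]⟩
  refine ⟨hA, AffineSubspace.mk' p (LinearMap.ker f), ⟨⟨p, AffineSubspace.self_mem_mk' _ _⟩, ?_⟩,
    ?_, fun x hx => ?_⟩
  · rw [AffineSubspace.direction_mk', add_comm, ← finrank_self (ZMod 5),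
      ← finrank_eq_of_surjective hsurj, finrank_fin_fun]
  · rw [hmem, map_zero]
    exact zero_ne_one
  · rw [hmem, hmem]
    exact (hf x hx).imp_right hneg

theorem ncard_inter_affineSubspace {R V : Type*} [Ring R] [AddCommGroup V] [Module R V]
    {A : Finset V} {T : AffineSubspace R V} {t : V} (ht : t ∈ T) :
    ((A : Set V) ∩ T).ncard = #(fibre A T.direction.mkQ (T.direction.mkQ t)) := by
  rw [← Set.ncard_coe_finset]
  congr 1
  ext a
  rw [Set.mem_inter_iff, mem_coe, SetLike.mem_coe, mem_coe, mem_fibre, Submodule.mkQ_apply,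
    Submodule.mkQ_apply, Submodule.Quotient.eq, ← vsub_eq_sub,
    AffineSubspace.vsub_right_mem_direction_iff_mem ht]

end Affine

end

theorem proposition2p4 (n : ℕ) (hn : 3 ≤ n) (A : Set (Fin n → ZMod 5))
    (hA : IsSumFree A) (hcard : 28 * 5 ^ (n - 3) ≤ A.ncard)
    (hT : ∃ T : AffineSubspace (ZMod 5) (Fin n → ZMod 5),
      HasCodim T 2 ∧ 3 * 5 ^ (n - 3) < (A ∩ (T : Set (Fin n → ZMod 5))).ncard) :
    IsNormalSumFree A ∨ IsVLSet A := by
  have := fact_prime_five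
  lift A to Finset (Fin n → ZMod 5) using A.toFinite
  obtain ⟨T, ⟨⟨t, ht⟩, hrank⟩, hdense⟩ := hT
  rw [Set.ncard_coe_finset] at hcard
  rw [ncard_inter_affineSubspace ht] at hdense
  by_cases hf : ∀ f : (Fin n → ZMod 5) →ₗ[ZMod 5] ZMod 5, ∃ a ∈ A, f a ≠ 1 ∧ f a ≠ 4
  · have hL : IsLargeNonNormal A (n - 3) :=
      ⟨by rw [Module.finrank_fin_fun]; omega, hA, hcard, hf⟩
    obtain ⟨φ, hφ, hsupp, hhalf⟩ := hL.exists_support_eq (by omega) hdense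
    obtain ⟨h, hφh, hmem⟩ := hL.exists_mem_iff_mem_lambdaFibre hφ hsupp hhalf
    exact Or.inr (isVLSet_of_forall_mem_iff hn hφh hmem)
  · push Not at hf
    obtain ⟨f, hf⟩ := hf
    have hne : A.Nonempty := Finset.card_pos.1 (lt_of_lt_of_le (by positivity) hcard)
    exact Or.inl (isNormalSumFree_of_functional hA hne fun a ha => or_iff_not_imp_left.2 (hf a ha))
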